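/- **Letters.** Let $A=\{1,x,x'\}$ with the involution $1'=1$, $(x)'=x'$, $(x')'=x$; its elements are called anchors. For a 5-tuple write $g=(g^l,g^{la},g^c,g^{ra},g^r)$. Put $g_{xx'}=(1,1,x,x',1)$, $G_{1,e}=\{g_{xx'}\}$, $G_{1,d}=G_{2,d}=\emptyset$, $G_i=G_{i,e}\cup G_{i,d}$. For $i\ge 2$ let $$G_{i,e}=\{(g,(g^{la})',g^l,(g^{ra})',g),\ (g,(g^{ra})',g^l,(g^{la})',g): g\in G_{i-1,e}\},$$ and for $i\ge 3$ let $G_{i,d}$ be the set of all $g\in G_{i-1}\times A\times G_{i-2}\times A\times G_{i-1}$ with $g^l\ne g^r$, $(g^c,(g^{la})')\in\{((g^l)^l,(g^l)^{la}),((g^l)^r,(g^l)^{ra})\}$ and $(g^c,(g^{ra})')\in\{((g^r)^l,(g^r)^{la}),((g^r)^r,(g^r)^{ra})\}$. Let $G^5=\bigcup_{i\ge1}G_i$, $G'=G^5\cup\{1\}$, $G=G^5\cup A$; the height of $g\in G_i$ is $i$ and the height of $1$ is $0$. **The monoid $F_1^1$.** $F_1^1=G^+/\rho$, where $\rho$ is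 the congruence on the free semigroup $G^+$ generated by the pairs $(xx'x,x)$, $(x'xx',x')$, $(g_{xx'},xx')$; $(1g,g),(g1,g)$ for $g\in G$; $(g^2,g)$ for $g\in G'$; and, for every $g\in G^5$ of height at least $2$, with $g^L=(g^{la})'g^lg^{la}$ and $g^R=(g^{ra})'g^rg^{ra}$, $$(g^cg^Lg,\,g),\quad (gg^Rg^c,\,g),\quad (g^rg^{ra}g(g^{la})'g^l,\ g^rg^{ra}g^c(g^{la})'g^l).$$ The class of a word $w$ is denoted $[w]$, and $F_1=F_1^1\setminus\{[1]\}$. **Landscapes.** A landscape is a word $g_0a_1g_1\cdots a_ng_n$ ($n\ge0$, $g_i\in G'$, $a_i\in A$) such that for every $i$ either $(g_{i-1},a_i)\in\{(g_i^l,g_i^{la}),(g_i^r,g_i^{ra})\}$ or $(g_i,a_i')\in\{(g_{i-1}^l,g_{i-1}^{la}),(g_{i-1}^r,g_{i-1}^{ra})\}$. If $u$ ends with the letter with which $v$ begins, $u*v$ is $uv$ with the double letter at the junction replaced by a single one. An uphill (downhill) is a landscape with $n\ge1$ in which each $g_{i-1}$ is the left or right entry of $g_i$ (each $g_i$ is the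 left or right entry of $g_{i-1}$). A river is a letter $g_i$ with $0<i<n$ such that $g_{i-1}$ and $g_{i+1}$ have height one more than $g_i$. Uplifting it replaces $g_{i-1}a_ig_ia_{i+1}g_{i+1}$ by $g_{i-1}$ if $g_{i-1}=g_{i+1}$ and $a_i=a_{i+1}'$, and otherwise replaces the letter $g_i$ by $(g_{i+1},a_{i+1}',g_i,a_i,g_{i-1})$. Write $u\xrightarrow{*}v$ if $v$ is obtained from $u$ by finitely many (possibly zero) upliftings. A valley is $d*p$ with $d$ a downhill and $p$ an uphill; a canyon is a valley whose first and last letters coincide, a one-letter word being also counted as a (trivial) canyon; a gorge is a canyon $w$ such that $w\xrightarrow{*}\sigma(w)$, where $\sigma(w)$ is its first letter. **Mountains.** A mountain is a landscape without rivers whose first and last letters are $1$; $M^1$ is the set of mountains. For $u\in M^1$, $u\neq 1$, $\lambda_l(u)$ is the longest prefix of $u$ that is an uphill, $\lambda_r(u)$ the longest suffix that is a downhill, and $\kappa(u)$ the last letter of $\lambda_l(u)$; also $\lambda_l(1)=\lambda_r(1)=\kappa(1)=1$. For $u,v\in M^1$, $u\odot v$ is the unique mountain $w$ with $u*v\xrightarrow{*}w$.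 In $(M^1,\odot)$ and in $F_1^1$: $s$ is idempotent if $ss=s$; $t$ is an inverse of $s$ if $sts=s$ and $tst=t$; $s\le t$ means $s=et=tf$ for some idempotents $e,f$; and $s<t$ means $s\le t$ and $s\ne t$. **Proposition.** Let $u,v\in M^1$. (i) $u$ is an idempotent if and only if $\lambda_r(u)*\lambda_l(u)$ is a gorge. (ii) $v$ is an inverse of $u$ if and only if $\lambda_r(u)*\lambda_l(v)$ and $\lambda_r(v)*\lambda_l(u)$ are both gorges. (iii) $v<u$ if and only if there are $a_1,a_2\in A$, a word $u_1$ that is an uphill or a letter of $G^5$, and a word $u_2$ that is a downhill or a letter of $G^5$, such that $\lambda_l(v)=\lambda_l(u)\,a_1\,u_1$, $\lambda_r(v)=u_2\,a_2\,\lambda_r(u)$, and $u_2\,a_2\,\kappa(u)\,a_1\,u_1$ is a gorge. Each of the three equivalences holds both when its left-hand side is read in $(M^1,\odot)$ and when it is read in $F_1^1$ for the classes $[u]$ and $[v]$. -/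

import Mathlib

namespace FreeRegular

/-! ### Anchors, 5-tuples and generators -/

/-- The set `A = {1, x, x'}` of anchors. -/
inductive Anchor : Type
  | one : Anchor
  | x : Anchor
  | x' : Anchor

/-- The involution on anchors: `1' = 1`, `x ↦ x'`, `x' ↦ x`. -/
def Anchor.inv : Anchor → Anchor
  | .one => .one
  | .x => .x'
  | .x' => .x

/-- Formal letters: anchors, and 5-tuples `(g^l, g^la, g^c, g^ra, g^r)` with anchors in the second
and fourth entries.  The generators are singled out among these below. -/
inductive Letter : Type
  | anchor (a : Anchor) : Letter
  | tuple (l : Letter) (la : Anchor) (c : Letter) (ra : Anchor) (r : Letter) : Letter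

/-- `g_{xx'} = (1, 1, x, x', 1)`. -/
def gxx : Letter := .tuple (.anchor .one) .one (.anchor .x) .x' (.anchor .one)

/-- The sets `G_{i,e}` (for `i ≥ 1`; the value at `0` is empty). -/
def Ge : ℕ → Set Letter
  | 0 => ∅
  | 1 => {gxx}
  | n + 2 => {h | ∃ l la c ra r, Letter.tuple l la c ra r ∈ Ge (n + 1) ∧
      (h = .tuple (.tuple l la c ra r) la.inv l ra.inv (.tuple l la c ra r) ∨
       h = .tuple (.tuple l la c ra r) ra.inv l la.inv (.tuple l la c ra r))}

/-- `h.IsEntryAt a g`: the pair `(h, a)` is `(g^l, g^la)` or `(g^r, g^ra)`.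
In other words, the triplet `h a g` is left anchored. -/
def Letter.IsEntryAt (h : Letter) (a : Anchor) : Letter → Prop
  | .anchor _ => False
  | .tuple l la _ ra r => (h = l ∧ a = la) ∨ (h = r ∧ a = ra)

/-- The sets `G_{i,d}` (for `i ≥ 1`; the value at `0` is empty). -/
def Gd : ℕ → Set Letter
  | 0 => ∅
  | 1 => ∅
  | 2 => ∅
  | n + 3 => {g | ∃ l la c ra r, g = .tuple l la c ra r ∧
      l ∈ Ge (n + 2) ∪ Gd (n + 2) ∧ c ∈ Ge (n + 1) ∪ Gd (n + 1) ∧ r ∈ Ge (n + 2) ∪ Gd (n + 2) ∧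
      l ≠ r ∧ c.IsEntryAt la.inv l ∧ c.IsEntryAt ra.inv r}

/-- `G^5`, the union of all the sets `G_i = G_{i,e} ∪ G_{i,d}`, `i ≥ 1`. -/
def G5 : Set Letter := {g | ∃ i : ℕ, 1 ≤ i ∧ g ∈ Ge i ∪ Gd i}

/-- The generating set `G = A ∪ G^5`. -/
def Gen : Type := {g : Letter // (∃ a, g = .anchor a) ∨ g ∈ G5}

/-- The set `G' = G^5 ∪ {1}`. -/
def Vertex : Type := {g : Letter // g = .anchor .one ∨ g ∈ G5}

/-- An anchor as a generator. -/
def Anchor.gen (a : Anchor) : Gen := ⟨.anchor a, Or.inl ⟨a, rfl⟩⟩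

/-- The inclusion of `G'` in `G`. -/
def Vertex.gen (g : Vertex) : Gen := ⟨g.1, g.2.imp (fun h => ⟨.one, h⟩) id⟩

/-- The letter `1` of `G'`. -/
def Vertex.one : Vertex := ⟨.anchor .one, Or.inl rfl⟩

/-- `g_{xx'}` as an element of `G'`. -/
def Vertex.gxx : Vertex := ⟨FreeRegular.gxx, Or.inr ⟨1, le_refl 1, Or.inl rfl⟩⟩

/-- The nesting depth of the left entries; it is `0` on `1` and `i` on the elements of `G_i`. -/
def Letter.height : Letter → ℕ
  | .anchor _ => 0
  | .tuple l _ _ _ _ => l.height + 1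

/-- The height of an element of `G'`. -/
def Vertex.height (g : Vertex) : ℕ := g.1.height

/-! ### The presentation of `F_1` with an identity adjoined -/

open FreeSemigroup in
/-- The defining relations.  Here `g^L = (g^la)' g^l g^la` and `g^R = (g^ra)' g^r g^ra`,
`g^r · g · g^l = g^r g^ra g (g^la)' g^l` and `g^r · g^c · g^l = g^r g^ra g^c (g^la)' g^l`. -/
inductive Rel : FreeSemigroup Gen → FreeSemigroup Gen → Prop
  | x_x'_x : Rel (of Anchor.x.gen * of Anchor.x'.gen * of Anchor.x.gen) (of Anchor.x.gen)
  | x'_x_x' : Rel (of Anchor.x'.gen * of Anchor.x.gen * of Anchor.x'.gen) (of Anchor.x'.gen)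
  | gxx : Rel (of Vertex.gxx.gen) (of Anchor.x.gen * of Anchor.x'.gen)
  | one_mul (g : Gen) : Rel (of Anchor.one.gen * of g) (of g)
  | mul_one (g : Gen) : Rel (of g * of Anchor.one.gen) (of g)
  | sq (g : Vertex) : Rel (of g.gen * of g.gen) (of g.gen)
  | left (g l c r : Vertex) (la ra : Anchor) (hg : g.1 = .tuple l.1 la c.1 ra r.1)
      (h2 : 2 ≤ g.height) :
      Rel (of c.gen * (of la.inv.gen * of l.gen * of la.gen) * of g.gen) (of g.gen)
  | right (g l c r : Vertex) (la ra : Anchor) (hg : g.1 = .tuple l.1 la c.1 ra r.1)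
      (h2 : 2 ≤ g.height) :
      Rel (of g.gen * (of ra.inv.gen * of r.gen * of ra.gen) * of c.gen) (of g.gen)
  | middle (g l c r : Vertex) (la ra : Anchor) (hg : g.1 = .tuple l.1 la c.1 ra r.1)
      (h2 : 2 ≤ g.height) :
      Rel (of r.gen * of ra.gen * of g.gen * of la.inv.gen * of l.gen)
        (of r.gen * of ra.gen * of c.gen * of la.inv.gen * of l.gen)

/-- The monoid `F_1^1 = G⁺ / ρ`, where `ρ` is the congruence generated by the relations. The
semigroup `F_1` is obtained from it by removing the class `[1]`. -/
abbrev FOne : Type := (conGen Rel).Quotient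

/-! ### Landscapes -/

/-- An alternating word `g₀ a₁ g₁ ⋯ aₙ gₙ` (`n ≥ 0`) of letters `gⱼ ∈ G'` and anchors `aⱼ`. -/
@[ext]
structure AltWord : Type where
  /-- the first letter `g₀` -/
  start : Vertex
  /-- the pairs `(a₁, g₁), …, (aₙ, gₙ)` -/
  steps : List (Anchor × Vertex)

namespace AltWord

/-- The word in the free semigroup on `G`. -/
def word (w : AltWord) : FreeSemigroup Gen :=
  ⟨w.start.gen, w.steps.flatMap fun s => [s.1.gen, s.2.gen]⟩

/-- The one-letter word `g`. -/
def single (g : Vertex) : AltWord := ⟨g, []⟩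

/-- The last letter of a word. -/
def last (w : AltWord) : Vertex := (w.steps.map Prod.snd).getLastD w.start

/-- `w₁ * w₂`: the word `w₁ w₂` with the double letter at the junction replaced by a single one
(meaningful when the last letter of `w₁` is the first letter of `w₂`). -/
def star (w₁ w₂ : AltWord) : AltWord := ⟨w₁.start, w₁.steps ++ w₂.steps⟩

/-- The word `w₁ a w₂`. -/
def join (w₁ : AltWord) (a : Anchor) (w₂ : AltWord) : AltWord :=
  ⟨w₁.start, w₁.steps ++ (a, w₂.start) :: w₂.steps⟩

/-- All triplets `g_{i-1} a_i g_i` of the word with first letter `g` satisfy `R`. -/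
def Along (R : Vertex → Anchor → Vertex → Prop) : Vertex → List (Anchor × Vertex) → Prop
  | _, [] => True
  | g, (a, h) :: t => R g a h ∧ Along R h t

/-- The triplet `g a h` is anchored: `g a h` is left anchored, i.e. `(g, a)` is `(h^l, h^la)` or
`(h^r, h^ra)`, or it is right anchored, i.e. `(h, a)` is `(g^l, (g^la)')` or `(g^r, (g^ra)')`. -/
def Anchored (g : Vertex) (a : Anchor) (h : Vertex) : Prop :=
  g.1.IsEntryAt a h.1 ∨ h.1.IsEntryAt a.inv g.1

/-- `g` is the left or the right entry of `h`. -/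
def IsSideOf (g h : Vertex) : Prop := ∃ a, g.1.IsEntryAt a h.1

/-- Landscapes. -/
def IsLandscape (w : AltWord) : Prop := Along Anchored w.start w.steps

/-- Uphills. -/
def IsUphill (w : AltWord) : Prop :=
  w.IsLandscape ∧ w.steps ≠ [] ∧ Along (fun g _ h => IsSideOf g h) w.start w.steps

/-- Downhills. -/
def IsDownhill (w : AltWord) : Prop :=
  w.IsLandscape ∧ w.steps ≠ [] ∧ Along (fun g _ h => IsSideOf h g) w.start w.steps

/-- Valleys: a downhill followed by an uphill. -/
def IsValley (w : AltWord) : Prop :=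
  ∃ d p : AltWord, d.IsDownhill ∧ p.IsUphill ∧ d.last = p.start ∧ w = d.star p

/-- The word has a river: a letter `gᵢ`, not the first nor the last one, such that `g_{i-1}` and
`g_{i+1}` both have height one more than `gᵢ`. -/
def HasRiver (w : AltWord) : Prop :=
  ∃ (p : AltWord) (a b : Anchor) (g k : Vertex) (q : List (Anchor × Vertex)),
    w = ⟨p.start, p.steps ++ (a, g) :: (b, k) :: q⟩ ∧
      p.last.height = g.height + 1 ∧ k.height = g.height + 1

/-- Uplifting of a river `g` of a landscape `⋯ f a g b k ⋯`, where `f = p.last`: if `f = k` and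
`a = b'` then `f a g b k` is replaced by `f`; otherwise the letter `g` is replaced by the 5-tuple
`(k, b', g, a, f)`. -/
inductive Uplift : AltWord → AltWord → Prop
  | cancel (p : AltWord) (a b : Anchor) (g k : Vertex) (q : List (Anchor × Vertex))
      (hu : IsLandscape ⟨p.start, p.steps ++ (a, g) :: (b, k) :: q⟩)
      (hf : p.last.height = g.height + 1) (hk : k.height = g.height + 1)
      (h : p.last = k ∧ a = b.inv) :
      Uplift ⟨p.start, p.steps ++ (a, g) :: (b, k) :: q⟩ ⟨p.start, p.steps ++ q⟩
  | lift (p : AltWord) (a b : Anchor) (g k : Vertex) (q : List (Anchor × Vertex))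
      (hu : IsLandscape ⟨p.start, p.steps ++ (a, g) :: (b, k) :: q⟩)
      (hf : p.last.height = g.height + 1) (hk : k.height = g.height + 1)
      (h : ¬ (p.last = k ∧ a = b.inv))
      (n : Vertex) (hn : n.1 = .tuple k.1 b.inv g.1 a p.last.1) :
      Uplift ⟨p.start, p.steps ++ (a, g) :: (b, k) :: q⟩
        ⟨p.start, p.steps ++ (a, n) :: (b, k) :: q⟩

/-- The reflexive and transitive closure of uplifting of rivers. -/
def UpliftStar : AltWord → AltWord → Prop := Relation.ReflTransGen Uplift

/-- Canyons: valleys whose first and last letters coincide. A one-letter word is counted as a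
(trivial) canyon. -/
def IsCanyon (w : AltWord) : Prop := (w.IsValley ∨ w.steps = []) ∧ w.start = w.last

/-- Gorges: canyons that reduce to their first letter by uplifting of rivers. -/
def IsGorge (w : AltWord) : Prop := w.IsCanyon ∧ UpliftStar w (single w.start)

open Classical in
/-- The steps of the longest prefix along which each letter is a side entry of the next one. -/
noncomputable def climb : Vertex → List (Anchor × Vertex) → List (Anchor × Vertex)
  | _, [] => []
  | g, (a, h) :: t => if IsSideOf g h then (a, h) :: climb h t else []

/-- The left hill: the longest prefix which is an uphill (and just the first letter if there is no
such prefix). -/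
noncomputable def leftHill (w : AltWord) : AltWord := ⟨w.start, climb w.start w.steps⟩

open Classical in
/-- The longest suffix of the word, with first letter `g` and given steps, along which each letter
has the next one as a side entry. -/
noncomputable def descent : Vertex → List (Anchor × Vertex) → AltWord
  | g, [] => ⟨g, []⟩
  | g, (a, h) :: t =>
      if Along (fun g _ h => IsSideOf h g) g ((a, h) :: t) then ⟨g, (a, h) :: t⟩ else descent h t

/-- The right hill: the longest suffix which is a downhill (and just the last letter if there is no
such suffix). -/
noncomputable def rightHill (w : AltWord) : AltWord := descent w.start w.steps

/-- Mountains (the trivial one `1` included): landscapes from `1` to `1` with no rivers. -/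
def IsMountain (w : AltWord) : Prop :=
  w.IsLandscape ∧ w.start = Vertex.one ∧ w.last = Vertex.one ∧ ¬ w.HasRiver

end AltWord

/-! ### The monoid of mountains -/

/-- The set of all mountains. -/
def Mountain : Type := {w : AltWord // w.IsMountain}

namespace Mountain

/-- The trivial mountain `1`. -/
def trivial : Mountain :=
  ⟨AltWord.single Vertex.one, True.intro, rfl, rfl, by
    rintro ⟨p, a, b, g, k, q, h, -⟩
    have h' := congrArg AltWord.steps h
    simp [AltWord.single] at h'⟩

instance : Nonempty Mountain := ⟨trivial⟩

/-- `u ⊙ v` is the unique mountain obtained from `u * v` by uplifting rivers until none is left. -/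
noncomputable instance : Mul Mountain :=
  ⟨fun u v => Classical.epsilon fun w : Mountain => AltWord.UpliftStar (u.1.star v.1) w.1⟩

/-- The left hill of a mountain. -/
noncomputable def leftHill (u : Mountain) : AltWord := u.1.leftHill

/-- The right hill of a mountain. -/
noncomputable def rightHill (u : Mountain) : AltWord := u.1.rightHill

/-- The peak of a mountain: the letter at which its left hill ends (it is `1` for the trivial
mountain, and the only ridge otherwise). -/
noncomputable def peak (u : Mountain) : Vertex := u.leftHill.last

/-- The element `[u]` of `F_1^1` represented by a mountain `u`. -/
def cls (u : Mountain) : FOne := (u.1.word : (conGen Rel).Quotient)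

end Mountain

/-! ### Inverses and the natural partial order -/

/-- `t` is a (von Neumann) inverse of `s`. -/
def IsInverse {S : Type*} [Mul S] (t s : S) : Prop := s * t * s = s ∧ t * s * t = t

/-- The natural partial order: `s ≤ t` iff `s = e t = t f` for some idempotents `e`, `f`. -/
def NaturalLE {S : Type*} [Mul S] (s t : S) : Prop :=
  ∃ e f : S, IsIdempotentElem e ∧ IsIdempotentElem f ∧ s = e * t ∧ s = t * f

/-- The strict natural partial order. -/
def NaturalLT {S : Type*} [Mul S] (s t : S) : Prop := NaturalLE s t ∧ s ≠ t

/-- The condition describing `v < u`: `λ_l(v) = λ_l(u) a₁ u₁` and `λ_r(v) = u₂ a₂ λ_r(u)` for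
some anchors `a₁`, `a₂`, some `u₁` that is an uphill or a letter of `G^5`, and some `u₂` that is a
downhill or a letter of `G^5`, such that `u₂ a₂ κ(u) a₁ u₁` is a gorge. -/
def GorgeExtension (v u : Mountain) : Prop :=
  ∃ (a₁ a₂ : Anchor) (u₁ u₂ : AltWord),
    (u₁.IsUphill ∨ ∃ g : Vertex, g.1 ∈ G5 ∧ u₁ = AltWord.single g) ∧
    (u₂.IsDownhill ∨ ∃ g : Vertex, g.1 ∈ G5 ∧ u₂ = AltWord.single g) ∧
    v.leftHill = u.leftHill.join a₁ u₁ ∧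
    v.rightHill = u₂.join a₂ u.rightHill ∧
    (u₂.join a₂ ((AltWord.single u.peak).join a₁ u₁)).IsGorge

end FreeRegular

namespace FreeRegular

/-! ### Structure of the letters -/

/-! Uplifting is treated as a rewriting system on paths with a fixed first letter. Consecutive
letters differ by one in height, so two rivers are never adjacent and upliftings at different rivers
commute (`Step.diamond`). Hence common reducibility, `Joinable`, is an equivalence relation
compatible with concatenation. The irreducible landscapes are the hills, paths that first rise and
then fall; every landscape reduces to a hill (`exists_steps_hill`), and equivalent hills are equal
(`Hill.eq_of_joinable`). The product of mountains is thus concatenation up to this equivalence.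

The map `cls` from mountains to `FOne` is an isomorphism. For injectivity, each generator is sent to
a loop at `1` and the defining relations are shown to hold up to `Joinable` (`Rel.joinable`);
evaluating the word of a mountain in this way gives the mountain back. Conversely, uplifting does
not change the class in the presented monoid (`Step.pathCls_eq`), and every class is that of a
landscape from `1` to `1`, so `cls` is multiplicative and surjective.

There remains a calculation with hills. Write `u = p d` and `v = q c`, with peaks `k` and `m`. A
gorge is a valley equivalent to the empty path at its first letter. The key fact is
`joinable_nil_of_absorbed`: if `p w d` is equivalent to `p d` for a loop `w` at the peak, then `w`
is equivalent to the empty path. With `w = d p` this settles idempotents. For inverses, `w` is a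
product of two valleys, and a product equivalent to the empty path, in both orders, forces each
factor to be so. For the order, `v = eu = uf` gives `q = p P` and `c = D d`; if `w` is the reversal
of `u`, an inverse of `u`, then `v w v = v` reduces to the statement that `D P` is a gorge. -/

@[simp] theorem Anchor.inv_inv (a : Anchor) : a.inv.inv = a := by cases a <;> rfl

theorem Anchor.inv_injective : Function.Injective Anchor.inv := fun a b h => by
  rw [← a.inv_inv, h, b.inv_inv]

theorem height_of_mem_Ge {n : ℕ} : ∀ {t : Letter}, t ∈ Ge n → t.height = n := by
  induction n using Nat.strong_induction_on with
  | _ n ih =>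
    intro t ht
    match n, ih, ht with
    | 0, _, ht => exact ht.elim
    | 1, _, ht => obtain rfl : t = gxx := ht; rfl
    | n + 2, ih, ht =>
      obtain ⟨l, la, c, ra, r, h, rfl | rfl⟩ := ht <;>
        simpa [Letter.height] using ih (n + 1) (by omega) h

theorem height_of_mem {n : ℕ} : ∀ {t : Letter}, t ∈ Ge n ∪ Gd n → t.height = n := by
  induction n using Nat.strong_induction_on with
  | _ n ih =>
    rintro t (ht | ht)
    · exact height_of_mem_Ge ht
    · match n, ih, ht with
      | 0, _, ht => exact ht.elim
      | 1, _, ht => exact ht.elim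
      | 2, _, ht => exact ht.elim
      | n + 3, ih, ht =>
        obtain ⟨l, la, c, ra, r, rfl, hl, -⟩ := ht
        simpa [Letter.height] using ih (n + 2) (by omega) hl

theorem sides_of_mem_Ge {n : ℕ} : ∀ {l la c ra r}, Letter.tuple l la c ra r ∈ Ge n →
    l = r ∧ la ≠ ra := by
  induction n using Nat.strong_induction_on with
  | _ n ih =>
    intro l la c ra r ht
    match n, ih, ht with
    | 0, _, ht => exact ht.elim
    | 1, _, ht =>
      obtain ⟨rfl, rfl, -, rfl, rfl⟩ := Letter.tuple.inj (show _ = gxx from ht)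
      exact ⟨rfl, nofun⟩
    | n + 2, ih, ht =>
      obtain ⟨l', la', c', ra', r', h, h' | h'⟩ := ht <;>
      · obtain ⟨rfl, rfl, -, rfl, rfl⟩ := Letter.tuple.inj h'
        have := (ih (n + 1) (by omega) h).2
        exact ⟨rfl, fun h => this (by simp [Anchor.inv_injective h])⟩

theorem left_isVertex_of_mem_Ge {n : ℕ} {l la c ra r} (h : Letter.tuple l la c ra r ∈ Ge n) :
    l = .anchor .one ∨ l ∈ G5 := by
  match n, h with
  | 0, h => exact h.elim
  | 1, h => exact Or.inl (Letter.tuple.inj (show _ = gxx from h)).1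
  | n + 2, h =>
    obtain ⟨l', la', c', ra', r', h₁, h₂ | h₂⟩ := h <;>
    · obtain ⟨h₂, -⟩ := Letter.tuple.inj h₂
      exact Or.inr ⟨n + 1, by omega, Or.inl (h₂ ▸ h₁)⟩

/-! ### Side entries, heights, and the tuples created by uplifting -/

namespace Vertex

/-- `g` is the left or the right entry of `h`, with anchor `a`. -/
def Up (g : Vertex) (a : Anchor) (h : Vertex) : Prop := g.1.IsEntryAt a h.1

theorem val_inj {g h : Vertex} : g.1 = h.1 ↔ g = h := ⟨Subtype.ext, congrArg _⟩

theorem mem_of_height {g : Vertex} {n : ℕ} (h : g.height = n + 1) :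
    g.1 ∈ Ge (n + 1) ∪ Gd (n + 1) := by
  obtain ⟨g, rfl | ⟨i, hi, hg⟩⟩ := g
  · cases h
  · have := height_of_mem hg
    change g.height = n + 1 at h
    rwa [← h, this]

theorem eq_gxx_of_height {g : Vertex} (h : g.height = 1) : g = gxx :=
  Subtype.ext ((mem_of_height h).elim id False.elim)

theorem up_gxx_iff {h : Vertex} {a : Anchor} :
    h.Up a gxx ↔ h = one ∧ (a = .one ∨ a = .x') := by
  rw [← val_inj, and_or_left]
  rfl

theorem not_up_one {h : Vertex} {a : Anchor} : ¬ h.Up a one := id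

/-- `g` is the 5-tuple `(l, la, c, ra, r)` of an element of `G⁵` of height at least two. -/
structure IsTuple (g l : Vertex) (la : Anchor) (c : Vertex) (ra : Anchor) (r : Vertex) : Prop where
  eq : g.1 = .tuple l.1 la c.1 ra r.1
  up_left : c.Up la.inv l
  up_right : c.Up ra.inv r
  ne : ¬ (r = l ∧ ra = la)
  height_left : l.height = c.height + 1
  height_right : r.height = c.height + 1

/-- The two families are treated uniformly: in `Ge` the side letters agree and their anchors differ,
in `Gd` the side letters differ. Both cases are covered by the condition `ne`, which is exactly what
excludes cancellation at a river. -/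
theorem eq_one_or_eq_gxx_or_isTuple (g : Vertex) :
    g = one ∨ g = gxx ∨ ∃ l la c ra r, IsTuple g l la c ra r := by
  obtain ⟨g, rfl | ⟨i, hi, hg⟩⟩ := g
  · exact Or.inl rfl
  refine Or.inr ?_
  match i, hi, hg with
  | 1, _, hg => exact Or.inl (Subtype.ext (hg.elim id False.elim))
  | i + 2, hi, Or.inl hg =>
    obtain ⟨l, la, c, ra, r, h, h'⟩ := id hg
    have hv := left_isVertex_of_mem_Ge h
    obtain ⟨rfl, hne⟩ := sides_of_mem_Ge h
    right
    have key : ∀ a b, ((a = la ∧ b = ra) ∨ (a = ra ∧ b = la)) →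
        g = .tuple (.tuple l la c ra l) a.inv l b.inv (.tuple l la c ra l) →
        ∃ l la c ra r, IsTuple ⟨g, Or.inr ⟨i + 2, hi, Or.inl hg⟩⟩ l la c ra r := by
      intro a b hab hg'
      refine ⟨⟨.tuple l la c ra l, Or.inr ⟨_, by omega, Or.inl h⟩⟩, a.inv, ⟨l, hv⟩, b.inv,
        ⟨.tuple l la c ra l, Or.inr ⟨_, by omega, Or.inl h⟩⟩, hg', ?_, ?_, ?_, rfl, rfl⟩
      · rcases hab with ⟨rfl, rfl⟩ | ⟨rfl, rfl⟩ <;> simp [Up, Letter.IsEntryAt]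
      · rcases hab with ⟨rfl, rfl⟩ | ⟨rfl, rfl⟩ <;> simp [Up, Letter.IsEntryAt]
      · rintro ⟨-, heq⟩
        rcases hab with ⟨rfl, rfl⟩ | ⟨rfl, rfl⟩
        · exact hne (Anchor.inv_injective heq).symm
        · exact hne (Anchor.inv_injective heq)
    rcases h' with h' | h'
    · exact key la ra (Or.inl ⟨rfl, rfl⟩) h'
    · exact key ra la (Or.inr ⟨rfl, rfl⟩) h'
  | i + 3, _, Or.inr hg =>
    obtain ⟨l, la, c, ra, r, h', hl, hc, hr, hne, hcl, hcr⟩ := id hg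
    have e1 := height_of_mem hl
    have e2 := height_of_mem hc
    have e3 := height_of_mem hr
    refine Or.inr ⟨⟨l, Or.inr ⟨_, by omega, hl⟩⟩, la, ⟨c, Or.inr ⟨_, by omega, hc⟩⟩, ra,
      ⟨r, Or.inr ⟨_, by omega, hr⟩⟩, h', hcl, hcr, fun h => hne (congrArg Subtype.val h.1).symm,
      ?_, ?_⟩
    · change l.height = c.height + 1; omega
    · change r.height = c.height + 1; omega

theorem IsTuple.height_eq {g l c r : Vertex} {la ra} (h : IsTuple g l la c ra r) :
    g.height = l.height + 1 := by
  rw [height, h.eq]; rfl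

theorem IsTuple.up_iff {g l c r : Vertex} {la ra} (h : IsTuple g l la c ra r) {k : Vertex}
    {a : Anchor} : k.Up a g ↔ (k = l ∧ a = la) ∨ (k = r ∧ a = ra) := by
  rw [← val_inj, ← val_inj, Up, h.eq]; rfl

theorem Up.height_eq {g h : Vertex} {a : Anchor} (hu : g.Up a h) :
    h.height = g.height + 1 := by
  obtain rfl | rfl | ⟨l, la, c, ra, r, ht⟩ := h.eq_one_or_eq_gxx_or_isTuple
  · exact hu.elim
  · obtain ⟨rfl, -⟩ := up_gxx_iff.1 hu
    rfl
  · have h1 := ht.height_left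
    have h2 := ht.height_right
    have h3 := ht.height_eq
    rcases ht.up_iff.1 hu with ⟨rfl, -⟩ | ⟨rfl, -⟩ <;> omega

/-- The middle entry of `gxx` is the anchor `x`, which is not in `G'`; so a middle entry in `G'`
already forces height at least two. -/
theorem isTuple_of_eq {g l c r : Vertex} {la ra : Anchor} (h : g.1 = .tuple l.1 la c.1 ra r.1) :
    IsTuple g l la c ra r := by
  obtain rfl | rfl | ⟨l', la', c', ra', r', ht⟩ := g.eq_one_or_eq_gxx_or_isTuple
  · cases h
  · obtain ⟨-, -, h, -⟩ := Letter.tuple.inj (show FreeRegular.gxx = _ from h)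
    obtain ⟨c, rfl | ⟨i, hi, hc⟩⟩ := c
    · cases h
    · have := height_of_mem hc
      rw [← show _ = c from h] at this
      change 0 = i at this
      omega
  · obtain ⟨h1, rfl, h2, rfl, h3⟩ := Letter.tuple.inj (h.symm.trans ht.eq)
    obtain rfl := Subtype.ext h1
    obtain rfl := Subtype.ext h2
    obtain rfl := Subtype.ext h3
    exact ht

/-- The 5-tuple needed to uplift a river exists. -/
theorem exists_tuple {f g k : Vertex} {a b : Anchor} (hf : g.Up a.inv f) (hk : g.Up b k)
    (hne : ¬ (f = k ∧ a = b.inv)) : ∃ n : Vertex, n.1 = .tuple k.1 b.inv g.1 a f.1 := by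
  have h1 := mem_of_height hf.height_eq
  have h2 := mem_of_height hk.height_eq
  suffices h : Letter.tuple k.1 b.inv g.1 a f.1 ∈ G5 from ⟨⟨_, Or.inr h⟩, rfl⟩
  by_cases hfk : f = k
  · subst hfk
    have hab : a ≠ b.inv := fun h => hne ⟨rfl, h⟩
    obtain ⟨g, hg⟩ := g
    obtain ⟨f, hf0⟩ := f
    generalize Vertex.height ⟨g, hg⟩ = m at h1
    change g.IsEntryAt a.inv f at hf
    change g.IsEntryAt b f at hk
    change f ∈ _ at h1
    rcases f with _ | ⟨l, la, c, ra, r⟩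
    · exact hf.elim
    have hlr : l = r → la = a.inv ∧ ra = b ∨ la = b ∧ ra = a.inv := by
      rintro rfl
      rcases hf with ⟨-, rfl⟩ | ⟨-, rfl⟩ <;> rcases hk with ⟨-, rfl⟩ | ⟨-, rfl⟩ <;> simp_all
    rcases h1 with h1 | h1
    · have hl := (sides_of_mem_Ge h1).1
      have hg : g = l := by rcases hf with h | h <;> [exact h.1; exact h.1.trans hl.symm]
      refine ⟨m + 2, by omega, Or.inl ⟨l, la, c, ra, r, h1, ?_⟩⟩
      subst hg
      rcases hlr hl with ⟨rfl, rfl⟩ | ⟨rfl, rfl⟩ <;> simp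
    -- Here `g` is an entry of `f` with two distinct anchors, hence both its left and its right
    -- entry, whereas the side entries of a member of `Gd` differ.
    · exfalso
      match m, h1 with
      | m + 2, ⟨l', la', c', ra', r', h, _, _, _, hne, _⟩ =>
        obtain ⟨rfl, -, -, -, rfl⟩ := Letter.tuple.inj h
        have hab' : a.inv ≠ b := fun h => hab (by rw [← h, Anchor.inv_inv])
        rcases hf with ⟨h1, h2⟩ | ⟨h1, h2⟩ <;> rcases hk with ⟨h3, h4⟩ | ⟨h3, h4⟩
        · exact hab' (h2.trans h4.symm)
        · exact hne (h1.symm.trans h3)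
        · exact hne (h3.symm.trans h1)
        · exact hab' (h2.trans h4.symm)
  -- Distinct neighbours call for a tuple in `Gd`, which needs `g` to have positive height; above
  -- height zero the only neighbour is `gxx`, so `f = k` there.
  · obtain hg | ⟨m, hg⟩ : g.height = 0 ∨ ∃ m, g.height = m + 1 := by
      cases g.height <;> simp
    · have e1 := hf.height_eq
      have e2 := hk.height_eq
      rw [hg] at e1 e2
      exact (hfk ((eq_gxx_of_height e1).trans (eq_gxx_of_height e2).symm)).elim
    · rw [hg] at h1 h2
      exact ⟨m + 3, by omega, Or.inr ⟨_, _, _, _, _, rfl, h2, mem_of_height hg, h1,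
        fun h => hfk (Subtype.ext h).symm, by simpa [Up] using hk, hf⟩⟩

end Vertex

end FreeRegular

namespace FreeRegular

open Relation

namespace AltWord

/-! ### Uplifting as a rewriting system on lists of steps -/

/-- The last letter of the word with first letter `g` and the given steps. -/
def lastOf (g : Vertex) (s : List (Anchor × Vertex)) : Vertex := (s.map Prod.snd).getLastD g

@[simp] theorem lastOf_nil (g : Vertex) : lastOf g [] = g := rfl

@[simp] theorem lastOf_cons (g : Vertex) (x : Anchor × Vertex) (s : List (Anchor × Vertex)) :
    lastOf g (x :: s) = lastOf x.2 s := by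
  simp only [lastOf, List.map_cons, List.getLastD_cons]

@[simp] theorem lastOf_append (g : Vertex) (s t : List (Anchor × Vertex)) :
    lastOf g (s ++ t) = lastOf (lastOf g s) t := by
  induction s generalizing g with
  | nil => rfl
  | cons x s ih => simp [ih]

theorem along_append {R : Vertex → Anchor → Vertex → Prop} {g : Vertex}
    {s t : List (Anchor × Vertex)} :
    Along R g (s ++ t) ↔ Along R g s ∧ Along R (lastOf g s) t := by
  induction s generalizing g with
  | nil => simp [Along]
  | cons x s ih => simp [Along, ih, and_assoc]

theorem Along.mono {R R' : Vertex → Anchor → Vertex → Prop} (h : ∀ g a k, R g a k → R' g a k)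
    {g : Vertex} {s : List (Anchor × Vertex)} (hs : Along R g s) : Along R' g s := by
  induction s generalizing g with
  | nil => trivial
  | cons x s ih => exact ⟨h _ _ _ hs.1, ih hs.2⟩

theorem Along.and {R R' : Vertex → Anchor → Vertex → Prop}
    {g : Vertex} {s : List (Anchor × Vertex)} (hs : Along R g s) (hs' : Along R' g s) :
    Along (fun g a k => R g a k ∧ R' g a k) g s := by
  induction s generalizing g with
  | nil => trivial
  | cons x s ih => exact ⟨⟨hs.1, hs'.1⟩, ih hs.2 hs'.2⟩

/-- The triplet `g a h` is right anchored. -/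
def Down (g : Vertex) (a : Anchor) (h : Vertex) : Prop := h.Up a.inv g

theorem anchored_iff {g h : Vertex} {a : Anchor} : Anchored g a h ↔ g.Up a h ∨ Down g a h := Iff.rfl

theorem Down.height_eq {g h : Vertex} {a : Anchor} (hd : Down g a h) :
    g.height = h.height + 1 := Vertex.Up.height_eq hd

theorem IsSideOf.height_eq {g h : Vertex} (hs : IsSideOf g h) : h.height = g.height + 1 :=
  let ⟨_, ha⟩ := hs
  Vertex.Up.height_eq ha

theorem anchored_and_isSideOf_iff {g h : Vertex} {a : Anchor} :
    Anchored g a h ∧ IsSideOf g h ↔ g.Up a h := by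
  refine ⟨fun ⟨h1, h2⟩ => h1.resolve_right fun h3 => ?_, fun h => ⟨Or.inl h, a, h⟩⟩
  have := Down.height_eq h3
  have := h2.height_eq
  omega

theorem anchored_and_isSideOf_iff' {g h : Vertex} {a : Anchor} :
    Anchored g a h ∧ IsSideOf h g ↔ Down g a h := by
  refine ⟨fun ⟨h1, h2⟩ => h1.resolve_left fun h3 => ?_, fun h => ⟨Or.inr h, a.inv, h⟩⟩
  have := Vertex.Up.height_eq h3
  have := h2.height_eq
  omega

/-- One uplifting of a river, on the steps of a word with a given first letter. -/
inductive Step : Vertex → List (Anchor × Vertex) → List (Anchor × Vertex) → Prop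
  | cancel {f g : Vertex} {a b : Anchor} (hb : b = a.inv) (hf : g.Up b f)
      (q : List (Anchor × Vertex)) : Step f ((a, g) :: (b, f) :: q) q
  | lift {f g k n : Vertex} {a b c : Anchor} (hc : c = b.inv) (hn : n.IsTuple k c g a f)
      (q : List (Anchor × Vertex)) : Step f ((a, g) :: (b, k) :: q) ((a, n) :: (b, k) :: q)
  | cons {f g : Vertex} (a : Anchor) {s t : List (Anchor × Vertex)} (h : Step g s t) :
      Step f ((a, g) :: s) ((a, g) :: t)

/-- Finitely many upliftings. -/
abbrev Steps (f : Vertex) : List (Anchor × Vertex) → List (Anchor × Vertex) → Prop :=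
  ReflTransGen (Step f)

theorem Steps.cons {f g : Vertex} (a : Anchor) {s t : List (Anchor × Vertex)} (h : Steps g s t) :
    Steps f ((a, g) :: s) ((a, g) :: t) :=
  ReflTransGen.lift (fun s => (a, g) :: s) (fun _ _ => Step.cons a) _ _ h

theorem Step.append_right {f : Vertex} {s t : List (Anchor × Vertex)} (h : Step f s t)
    (q : List (Anchor × Vertex)) : Step f (s ++ q) (t ++ q) := by
  induction h with
  | cancel hb hf p => exact .cancel hb hf _
  | lift hc hn p => exact .lift hc hn _
  | cons a h ih => exact .cons a ih

theorem Steps.append_right {f : Vertex} {s t : List (Anchor × Vertex)} (h : Steps f s t)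
    (q : List (Anchor × Vertex)) : Steps f (s ++ q) (t ++ q) :=
  ReflTransGen.lift (· ++ q) (fun _ _ h => h.append_right q) _ _ h

theorem Step.append_left {f : Vertex} (p : List (Anchor × Vertex)) {s t : List (Anchor × Vertex)}
    (h : Step (lastOf f p) s t) : Step f (p ++ s) (p ++ t) := by
  induction p generalizing f with
  | nil => exact h
  | cons x p ih => exact .cons _ (ih (by simpa using h))

theorem Steps.append_left {f g : Vertex} (p : List (Anchor × Vertex)) (hg : lastOf f p = g)
    {s t : List (Anchor × Vertex)} (h : Steps g s t) : Steps f (p ++ s) (p ++ t) := by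
  subst hg
  exact ReflTransGen.lift (p ++ ·) (fun _ _ h => h.append_left p) _ _ h

/-- Rewriting the factor `s` of `p s q`. -/
theorem Steps.between {f g : Vertex} (p q : List (Anchor × Vertex)) (hg : lastOf f p = g)
    {s t : List (Anchor × Vertex)} (h : Steps g s t) : Steps f (p ++ s ++ q) (p ++ t ++ q) :=
  (h.append_left p hg).append_right q

theorem Step.lastOf_eq {f : Vertex} {s t : List (Anchor × Vertex)} (h : Step f s t) :
    lastOf f s = lastOf f t := by
  induction h <;> simp_all

theorem Steps.lastOf_eq {f : Vertex} {s t : List (Anchor × Vertex)} (h : Steps f s t) :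
    lastOf f s = lastOf f t := by
  induction h with
  | refl => rfl
  | tail _ h ih => exact ih.trans h.lastOf_eq

/-- At a single river the rule and its result are determined, since `ne` separates cancelling from
lifting. Two adjacent letters cannot both be rivers, by comparison of heights, and a step leaves the
neighbours needed by any other river in place. -/
theorem Step.diamond {f : Vertex} {s t t' : List (Anchor × Vertex)} (h : Step f s t)
    (h' : Step f s t') : t = t' ∨ ∃ d, Step f t d ∧ Step f t' d := by
  induction h generalizing t' with
  | @cancel f g a b hb hf q =>
    subst hb
    cases h' with
    | cancel => exact Or.inl rfl
    | lift hc hn =>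
      subst hc
      exact (hn.ne ⟨rfl, by simp⟩).elim
    | cons _ h =>
      have h1 := hf.height_eq
      cases h with
      | cancel _ hf' => have := hf'.height_eq; omega
      | lift _ hn => have := hn.height_right; have := hn.up_right.height_eq; omega
      | cons _ h => exact Or.inr ⟨_, h, .cancel rfl hf _⟩
  | @lift f g k n a b c hc hn q =>
    subst hc
    cases h' with
    | cancel hb _ => exact (hn.ne ⟨rfl, by simp [hb]⟩).elim
    | lift hc hn' =>
      subst hc
      obtain rfl := Subtype.ext (hn.eq.trans hn'.eq.symm)
      exact Or.inl rfl
    | cons _ h =>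
      have h1 := hn.height_left
      cases h with
      | cancel _ hf' => have := hf'.height_eq; omega
      | lift _ hn => have := hn.height_right; have := hn.up_right.height_eq; omega
      | cons _ h => exact Or.inr ⟨_, .cons _ (.cons _ h), .lift rfl hn _⟩
  | @cons f g a s t h ih =>
    cases h' with
    | cancel hb hf =>
      subst hb
      have h1 := hf.height_eq
      cases h with
      | cancel _ hf' => have := hf'.height_eq; omega
      | lift _ hn => have := hn.height_right; have := hn.up_right.height_eq; omega
      | cons _ h => exact Or.inr ⟨_, .cancel rfl hf _, h⟩
    | lift hc hn =>
      subst hc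
      have h1 := hn.height_left
      cases h with
      | cancel _ hf' => have := hf'.height_eq; omega
      | lift _ hn => have := hn.height_right; have := hn.up_right.height_eq; omega
      | cons _ h => exact Or.inr ⟨_, .lift rfl hn _, .cons _ (.cons _ h)⟩
    | cons _ h' =>
      obtain rfl | ⟨d, h1, h2⟩ := ih h'
      · exact Or.inl rfl
      · exact Or.inr ⟨_, .cons a h1, .cons a h2⟩

theorem Step.locally_confluent {f : Vertex} (s t t' : List (Anchor × Vertex)) (h : Step f s t)
    (h' : Step f s t') : ∃ d, ReflGen (Step f) t d ∧ Steps f t' d := by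
  obtain rfl | ⟨d, h1, h2⟩ := h.diamond h'
  · exact ⟨_, .refl, .refl⟩
  · exact ⟨d, .single h1, .single h2⟩

/-- Two words have a common descendant under uplifting. -/
abbrev Joinable (f : Vertex) : List (Anchor × Vertex) → List (Anchor × Vertex) → Prop :=
  Join (Steps f)

/-- The one-step diamond yields confluence directly, so no termination argument is needed. -/
theorem Joinable.equivalence (f : Vertex) : Equivalence (Joinable f) :=
  equivalence_join_reflTransGen Step.locally_confluent

theorem Joinable.symm {f : Vertex} {s t : List (Anchor × Vertex)} (h : Joinable f s t) :
    Joinable f t s := (Joinable.equivalence f).symm h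

theorem Joinable.trans {f : Vertex} {s t r : List (Anchor × Vertex)} (h : Joinable f s t)
    (h' : Joinable f t r) : Joinable f s r := (Joinable.equivalence f).trans h h'

theorem Steps.joinable {f : Vertex} {s t : List (Anchor × Vertex)} (h : Steps f s t) :
    Joinable f s t := ⟨t, h, .refl⟩

theorem Joinable.refl (f : Vertex) (s : List (Anchor × Vertex)) : Joinable f s s :=
  Steps.joinable .refl

theorem Joinable.lastOf_eq {f : Vertex} {s t : List (Anchor × Vertex)} (h : Joinable f s t) :
    lastOf f s = lastOf f t :=
  let ⟨_, h1, h2⟩ := h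
  h1.lastOf_eq.trans h2.lastOf_eq.symm

theorem Joinable.append {f g : Vertex} {s s' t t' : List (Anchor × Vertex)} (h : Joinable f s t)
    (hg : lastOf f s = g) (h' : Joinable g s' t') : Joinable f (s ++ s') (t ++ t') := by
  subst hg
  obtain ⟨d, h1, h2⟩ := id h
  obtain ⟨d', h1', h2'⟩ := h'
  exact ⟨d ++ d', (h1.append_right s').trans (h1'.append_left d h1.lastOf_eq.symm),
    (h2.append_right t').trans
      (h2'.append_left d (h2.lastOf_eq.symm.trans h.lastOf_eq.symm))⟩

/-- Replacing the factor `s` of `p s q` by an equivalent one. -/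
theorem Joinable.between {f g : Vertex} (p q : List (Anchor × Vertex)) (hg : lastOf f p = g)
    {s t : List (Anchor × Vertex)} (h : Joinable g s t) :
    Joinable f (p ++ s ++ q) (p ++ t ++ q) :=
  ((Joinable.refl f p).append hg h).append rfl (Joinable.refl _ q)

/-! ### Words without rivers -/

/-- The word goes up. -/
abbrev Rises : Vertex → List (Anchor × Vertex) → Prop := Along Vertex.Up

/-- The word goes down. -/
abbrev Falls : Vertex → List (Anchor × Vertex) → Prop := Along Down

/-- The word goes up and then down. -/
def Hill (f : Vertex) (s : List (Anchor × Vertex)) : Prop :=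
  ∃ p d, s = p ++ d ∧ Rises f p ∧ Falls (lastOf f p) d

/-- Landscapes, in terms of the steps. -/
abbrev Land : Vertex → List (Anchor × Vertex) → Prop := Along Anchored

theorem Rises.land {f : Vertex} {s : List (Anchor × Vertex)} (h : Rises f s) : Land f s :=
  Along.mono (fun _ _ _ => Or.inl) h

theorem Falls.land {f : Vertex} {s : List (Anchor × Vertex)} (h : Falls f s) : Land f s :=
  Along.mono (fun _ _ _ => Or.inr) h

theorem Rises.hill {f : Vertex} {s : List (Anchor × Vertex)} (h : Rises f s) : Hill f s :=
  ⟨s, [], by simp, h, trivial⟩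

theorem Falls.hill {f : Vertex} {s : List (Anchor × Vertex)} (h : Falls f s) : Hill f s :=
  ⟨[], s, rfl, trivial, h⟩

theorem Hill.land {f : Vertex} {s : List (Anchor × Vertex)} (h : Hill f s) : Land f s := by
  obtain ⟨p, d, rfl, hp, hd⟩ := h
  exact along_append.2 ⟨hp.land, hd.land⟩

theorem Hill.cons_up {f g : Vertex} {a : Anchor} (h : f.Up a g) {s : List (Anchor × Vertex)}
    (hs : Hill g s) : Hill f ((a, g) :: s) := by
  obtain ⟨p, d, rfl, hp, hd⟩ := hs
  exact ⟨(a, g) :: p, d, rfl, ⟨h, hp⟩, by simpa using hd⟩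

theorem Hill.cons_inv {f g : Vertex} {a : Anchor} {s : List (Anchor × Vertex)}
    (hs : Hill f ((a, g) :: s)) : (f.Up a g ∧ Hill g s) ∨ (Down f a g ∧ Falls g s) := by
  obtain ⟨_ | ⟨x, p⟩, d, h, hp, hd⟩ := hs
  · obtain rfl := h
    exact Or.inr hd
  · obtain ⟨rfl, rfl⟩ := List.cons.inj h
    exact Or.inl ⟨hp.1, p, d, rfl, hp.2, by simpa using hd⟩

theorem Hill.tail {f g : Vertex} {a : Anchor} {s : List (Anchor × Vertex)}
    (hs : Hill f ((a, g) :: s)) : Hill g s :=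
  hs.cons_inv.elim And.right fun h => Falls.hill h.2

theorem Hill.not_step {f : Vertex} {s t : List (Anchor × Vertex)} (hs : Hill f s) :
    ¬ Step f s t := by
  intro h
  induction h with
  | cancel hb hf q =>
    have h1 := hf.height_eq
    obtain ⟨h, -⟩ | ⟨-, h, -⟩ := hs.cons_inv <;>
    · have := h.height_eq
      omega
  | lift hc hn q =>
    have h1 := hn.height_left
    have h2 := hn.height_right
    obtain ⟨h, -⟩ | ⟨-, h, -⟩ := hs.cons_inv <;>
    · have := h.height_eq
      omega
  | cons a h ih => exact ih hs.tail

theorem Hill.steps_eq {f : Vertex} {s t : List (Anchor × Vertex)} (hs : Hill f s)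
    (h : Steps f s t) : s = t := by
  induction h with
  | refl => rfl
  | tail _ h ih =>
    subst ih
    exact (hs.not_step h).elim

/-- Normal forms are unique. -/
theorem Hill.eq_of_joinable {f : Vertex} {s t : List (Anchor × Vertex)} (hs : Hill f s)
    (ht : Hill f t) (h : Joinable f s t) : s = t :=
  let ⟨_, h1, h2⟩ := h
  (hs.steps_eq h1).trans (ht.steps_eq h2).symm

theorem Hill.steps_of_joinable {f : Vertex} {s t : List (Anchor × Vertex)}
    (ht : Hill f t) (h : Joinable f s t) : Steps f s t := by
  obtain ⟨d, h1, h2⟩ := h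
  rwa [ht.steps_eq h2]

theorem Step.land {f : Vertex} {s t : List (Anchor × Vertex)} (h : Step f s t) (hs : Land f s) :
    Land f t := by
  induction h with
  | cancel hb hf q => exact hs.2.2
  | lift hc hn q =>
    subst hc
    exact ⟨Or.inl (hn.up_iff.2 (Or.inr ⟨rfl, rfl⟩)), Or.inr (hn.up_iff.2 (Or.inl ⟨rfl, rfl⟩)),
      hs.2.2⟩
  | cons a h ih => exact ⟨hs.1, ih hs.2⟩

theorem Steps.land {f : Vertex} {s t : List (Anchor × Vertex)} (h : Steps f s t)
    (hs : Land f s) : Land f t := by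
  induction h with
  | refl => exact hs
  | tail _ h ih => exact h.land ih

/-- Only the first letter `g` can be a river. Cancelling leaves a tail of the hill; lifting replaces
`g` by a letter `n` above both neighbours, so that `n` descends to `k` and the same situation recurs
on a shorter list. -/
theorem exists_steps_hill_cons {f g : Vertex} {a : Anchor} (h : Down f a g)
    {s : List (Anchor × Vertex)} (hs : Hill g s) :
    ∃ t, Hill f t ∧ Steps f ((a, g) :: s) t := by
  induction s generalizing f g a with
  | nil => exact ⟨_, Falls.hill (f := f) (s := [(a, g)]) ⟨h, trivial⟩, .refl⟩
  | cons x s ih =>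
    obtain ⟨b, k⟩ := x
    obtain ⟨hk, hs⟩ | hd := hs.cons_inv
    · by_cases hne : f = k ∧ a = b.inv
      · obtain ⟨rfl, rfl⟩ := hne
        exact ⟨s, hs, .single (.cancel (by simp) hk s)⟩
      · obtain ⟨n, hn⟩ := Vertex.exists_tuple h hk hne
        have hn := Vertex.isTuple_of_eq hn
        obtain ⟨t, ht, hst⟩ := ih (f := n) (a := b) (hn.up_iff.2 (Or.inl ⟨rfl, rfl⟩)) hs
        exact ⟨_, ht.cons_up (hn.up_iff.2 (Or.inr ⟨rfl, rfl⟩)),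
          .head (.lift rfl hn s) (hst.cons a)⟩
    · exact ⟨_, Falls.hill (f := f) (s := (a, g) :: (b, k) :: s) ⟨h, hd⟩, .refl⟩

/-- Normal forms exist. -/
theorem exists_steps_hill {f : Vertex} {s : List (Anchor × Vertex)} (hs : Land f s) :
    ∃ t, Hill f t ∧ Steps f s t := by
  induction s generalizing f with
  | nil => exact ⟨[], Rises.hill (f := f) trivial, .refl⟩
  | cons x s ih =>
    obtain ⟨a, g⟩ := x
    obtain ⟨t, ht, hst⟩ := ih hs.2
    obtain h | h := anchored_iff.1 hs.1
    · exact ⟨_, ht.cons_up h, hst.cons a⟩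
    · obtain ⟨r, hr, htr⟩ := exists_steps_hill_cons h ht
      exact ⟨r, hr, (hst.cons a).trans htr⟩

theorem Steps.exists_joinable {f : Vertex} {s : List (Anchor × Vertex)} (hs : Land f s) :
    ∃ p d, Rises f p ∧ Falls (lastOf f p) d ∧ lastOf (lastOf f p) d = lastOf f s ∧
      Joinable f s (p ++ d) := by
  obtain ⟨t, ⟨p, d, rfl, hp, hd⟩, h⟩ := exists_steps_hill hs
  exact ⟨p, d, hp, hd, by rw [h.lastOf_eq, lastOf_append], h.joinable⟩

/-! ### Comparison with the definitions on words -/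

theorem Uplift.step {u v : AltWord} (h : Uplift u v) :
    u.start = v.start ∧ Step u.start u.steps v.steps := by
  cases h with
  | cancel p a b g k q hu hf hk h =>
    refine ⟨rfl, .append_left _ ?_⟩
    obtain ⟨h1, rfl⟩ := h
    change lastOf _ _ = k at h1
    have hu := (along_append.1 hu).2
    rw [h1] at hu ⊢
    refine .cancel (by simp) (hu.2.1.resolve_right fun h => ?_) q
    have := Down.height_eq h
    omega
  | lift p a b g k q hu hf hk h n hn =>
    exact ⟨rfl, .append_left _ (.lift rfl (Vertex.isTuple_of_eq hn) q)⟩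

theorem Step.uplift {f : Vertex} {s t : List (Anchor × Vertex)} (h : Step f s t)
    (p : AltWord) (hp : p.last = f) (hu : Land p.start (p.steps ++ s)) :
    Uplift ⟨p.start, p.steps ++ s⟩ ⟨p.start, p.steps ++ t⟩ := by
  induction h generalizing p with
  | @cancel f g a b hb hf q =>
    exact .cancel p a b g f q hu (hp ▸ hf.height_eq) hf.height_eq ⟨hp, by simp [hb]⟩
  | @lift f g k n a b c hc hn q =>
    subst hc
    refine .lift p a b g k q hu (hp ▸ hn.height_right) hn.height_left ?_ n (hp ▸ hn.eq)
    rw [hp]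
    exact hn.ne
  | @cons f g a s t h ih =>
    simpa using ih ⟨p.start, p.steps ++ [(a, g)]⟩
      (by change lastOf _ _ = _; simp) (by simpa using hu)

/-- `Uplift` asks that the whole word be a landscape, `Step` only carries the anchoring near the
river; they agree because steps preserve landscapes. -/
theorem upliftStar_iff {f : Vertex} {s : List (Anchor × Vertex)} (hs : Land f s) {v : AltWord} :
    UpliftStar ⟨f, s⟩ v ↔ v.start = f ∧ Steps f s v.steps := by
  constructor
  · intro h
    induction h with
    | refl => exact ⟨rfl, .refl⟩
    | tail _ h ih =>
      obtain ⟨h1, h2⟩ := h.step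
      rw [← h1, ih.1]
      refine ⟨rfl, ih.2.tail ?_⟩
      rwa [← ih.1]
  · obtain ⟨g, t⟩ := v
    rintro ⟨rfl, h⟩
    change Steps g s t at h
    induction h with
    | refl => exact .refl
    | tail h' h ih =>
      exact ReflTransGen.tail (ih hs) (h.uplift (single g) rfl (Steps.land h' hs))

theorem hill_of_not_hasRiver {f : Vertex} {s : List (Anchor × Vertex)} (hs : Land f s)
    (h : ¬ HasRiver ⟨f, s⟩) : Hill f s := by
  induction s generalizing f with
  | nil => exact Rises.hill (f := f) trivial
  | cons x s ih =>
    obtain ⟨a, g⟩ := x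
    have hg : Hill g s := ih hs.2 fun ⟨p, a', b, g', k, q, h1, h2, h3⟩ => h
      ⟨⟨f, (a, g) :: p.steps⟩, a', b, g', k, q, by
        obtain ⟨rfl, rfl⟩ := AltWord.mk.inj h1
        rfl, by
        obtain ⟨rfl, rfl⟩ := AltWord.mk.inj h1
        change (lastOf _ _).height = _
        rw [lastOf_cons]
        exact h2, h3⟩
    obtain hu | hd := anchored_iff.1 hs.1
    · exact hg.cons_up hu
    · cases s with
      | nil => exact Falls.hill (f := f) (s := [(a, g)]) ⟨hd, trivial⟩
      | cons y s =>
        obtain ⟨hu, -⟩ | hd' := hg.cons_inv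
        · exact (h ⟨single f, a, y.1, g, y.2, s, rfl, Down.height_eq hd,
            Vertex.Up.height_eq hu⟩).elim
        · exact Falls.hill (f := f) (s := (a, g) :: y :: s) ⟨hd, hd'⟩

theorem Hill.of_append {f : Vertex} {p s : List (Anchor × Vertex)} (h : Hill f (p ++ s)) :
    Hill (lastOf f p) s := by
  induction p generalizing f with
  | nil => exact h
  | cons x p ih => simpa using ih h.tail

theorem Hill.not_hasRiver {f : Vertex} {s : List (Anchor × Vertex)} (h : Hill f s) :
    ¬ HasRiver ⟨f, s⟩ := by
  rintro ⟨p, a, b, g, k, q, h1, h2, h3⟩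
  obtain ⟨rfl, rfl⟩ := AltWord.mk.inj h1
  change (lastOf p.start p.steps).height = _ at h2
  obtain ⟨hu, -⟩ | ⟨-, hd, -⟩ := h.of_append.cons_inv
  · have := hu.height_eq
    omega
  · have := Down.height_eq hd
    omega

theorem isMountain_iff {w : AltWord} : w.IsMountain ↔
    w.start = Vertex.one ∧ Hill Vertex.one w.steps ∧ lastOf Vertex.one w.steps = Vertex.one := by
  obtain ⟨f, s⟩ := w
  constructor
  · rintro ⟨h1, rfl, h3, h4⟩
    exact ⟨rfl, hill_of_not_hasRiver h1 h4, h3⟩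
  · rintro ⟨rfl, h2, h3⟩
    exact ⟨h2.land, rfl, h3, h2.not_hasRiver⟩

theorem isUphill_iff {f : Vertex} {s : List (Anchor × Vertex)} :
    IsUphill ⟨f, s⟩ ↔ Rises f s ∧ s ≠ [] :=
  ⟨fun h => ⟨(Along.and h.1 h.2.2).mono fun _ _ _ => anchored_and_isSideOf_iff.1, h.2.1⟩,
    fun h => ⟨Rises.land h.1, h.2,
      h.1.mono fun _ _ _ h => (anchored_and_isSideOf_iff.2 h).2⟩⟩

theorem isDownhill_iff {f : Vertex} {s : List (Anchor × Vertex)} :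
    IsDownhill ⟨f, s⟩ ↔ Falls f s ∧ s ≠ [] :=
  ⟨fun h => ⟨(Along.and h.1 h.2.2).mono fun _ _ _ => anchored_and_isSideOf_iff'.1, h.2.1⟩,
    fun h => ⟨Falls.land h.1, h.2,
      h.1.mono fun _ _ _ h => (anchored_and_isSideOf_iff'.2 h).2⟩⟩

theorem climb_eq {f : Vertex} {p d : List (Anchor × Vertex)} (hp : Rises f p)
    (hd : Falls (lastOf f p) d) : climb f (p ++ d) = p := by
  induction p generalizing f with
  | nil =>
    cases d with
    | nil => rfl
    | cons x d =>
      refine if_neg fun h => ?_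
      have := h.height_eq
      have : f.height = _ := Down.height_eq hd.1
      omega
  | cons x p ih =>
    have h := ih hp.2 (by simpa using hd)
    rw [List.cons_append]
    exact (if_pos ⟨x.1, hp.1⟩).trans (congrArg _ h)

theorem descent_eq {f : Vertex} {p d : List (Anchor × Vertex)} (hp : Rises f p)
    (hd : Falls (lastOf f p) d) : descent f (p ++ d) = ⟨lastOf f p, d⟩ := by
  induction p generalizing f with
  | nil =>
    cases d with
    | nil => rfl
    | cons x d => exact if_pos (isDownhill_iff.2 ⟨hd, by simp⟩).2.2
  | cons x p ih =>
    have h := ih hp.2 (by simpa using hd)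
    rw [List.cons_append, lastOf_cons, ← h]
    refine if_neg fun h => ?_
    have := h.1.height_eq
    have := Vertex.Up.height_eq hp.1
    omega

end AltWord

end FreeRegular

namespace FreeRegular

open Relation AltWord

/-! ### Canonical hills -/

open Classical in
/-- A letter as an element of `G'` (`1` if it is not one). -/
noncomputable def Letter.toVertex (t : Letter) : Vertex :=
  if h : t = .anchor .one ∨ t ∈ G5 then ⟨t, h⟩ else Vertex.one

@[simp] theorem Vertex.toVertex_val (g : Vertex) : g.1.toVertex = g := dif_pos g.2

open Classical in
/-- The steps of an uphill from `1` to a given letter. -/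
noncomputable def Letter.ascent : Letter → List (Anchor × Vertex)
  | .anchor _ => []
  | .tuple l la c ra r => if c = .anchor .x then [(.one, Vertex.gxx)] else
      c.ascent ++ [(la.inv, l.toVertex), (la, (Letter.tuple l la c ra r).toVertex)]

open Classical in
/-- The steps of a downhill from a given letter to `1`. -/
noncomputable def Letter.descent : Letter → List (Anchor × Vertex)
  | .anchor _ => []
  | .tuple _ _ c ra r => if c = .anchor .x then [(.one, Vertex.one)] else
      [(ra.inv, r.toVertex), (ra, c.toVertex)] ++ c.descent

/-- The steps of a mountain from `1` to `1` representing a generator. -/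
noncomputable def Letter.loop : Letter → List (Anchor × Vertex)
  | .anchor .one => []
  | .anchor .x => [(.one, Vertex.gxx), (.x, Vertex.one)]
  | .anchor .x' => [(.x', Vertex.gxx), (.one, Vertex.one)]
  | .tuple l la c ra r => (Letter.tuple l la c ra r).ascent ++ (Letter.tuple l la c ra r).descent

namespace Vertex

theorem one_up_gxx : one.Up .one gxx := up_gxx_iff.2 ⟨rfl, Or.inl rfl⟩

theorem one_up_gxx' : one.Up .x' gxx := up_gxx_iff.2 ⟨rfl, Or.inr rfl⟩

theorem val_ne_x (g : Vertex) : g.1 ≠ .anchor .x := by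
  obtain ⟨g, rfl | ⟨i, hi, h⟩⟩ := g
  · nofun
  · rintro rfl
    have := height_of_mem h
    change 0 = i at this
    omega

@[simp] theorem ascent_one : one.1.ascent = [] := rfl

@[simp] theorem descent_one : one.1.descent = [] := rfl

@[simp] theorem ascent_gxx : gxx.1.ascent = [(.one, gxx)] := by
  change (FreeRegular.gxx).ascent = _
  simp [FreeRegular.gxx, Letter.ascent]

@[simp] theorem descent_gxx : gxx.1.descent = [(.one, one)] := by
  change (FreeRegular.gxx).descent = _
  simp [FreeRegular.gxx, Letter.descent]

theorem IsTuple.ascent_eq {g l c r : Vertex} {la ra : Anchor} (h : IsTuple g l la c ra r) :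
    g.1.ascent = c.1.ascent ++ [(la.inv, l), (la, g)] := by
  have := g.toVertex_val
  rw [h.eq] at this ⊢
  simp [Letter.ascent, c.val_ne_x, this]

theorem IsTuple.descent_eq {g l c r : Vertex} {la ra : Anchor} (h : IsTuple g l la c ra r) :
    g.1.descent = [(ra.inv, r), (ra, c)] ++ c.1.descent := by
  rw [h.eq]
  simp [Letter.descent, c.val_ne_x]

theorem loop_val (g : Vertex) : g.1.loop = g.1.ascent ++ g.1.descent := by
  obtain ⟨g, rfl | h⟩ := g
  · rfl
  · cases g with
    | anchor a =>
      obtain ⟨i, hi, h⟩ := h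
      have := height_of_mem h
      change 0 = i at this
      omega
    | tuple => rfl

/-- Induction along the middle entries. -/
theorem middle_induction {P : Vertex → Prop} (one : P one) (gxx : P gxx)
    (tuple : ∀ g l la c ra r, IsTuple g l la c ra r → P c → P g) (g : Vertex) : P g := by
  induction h : g.height using Nat.strong_induction_on generalizing g with
  | _ n ih =>
    obtain rfl | rfl | ⟨l, la, c, ra, r, ht⟩ := g.eq_one_or_eq_gxx_or_isTuple
    · exact one
    · exact gxx
    · have h1 := ht.height_eq
      have h2 := ht.height_left
      exact tuple _ _ _ _ _ _ ht (ih c.height (by omega) c rfl)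

/-- Induction along the left and right entries. -/
theorem side_induction {P : Vertex → Prop} (one : P one) (gxx : P gxx)
    (tuple : ∀ g l la c ra r, IsTuple g l la c ra r → P l → P r → P g) (g : Vertex) : P g := by
  induction h : g.height using Nat.strong_induction_on generalizing g with
  | _ n ih =>
    obtain rfl | rfl | ⟨l, la, c, ra, r, ht⟩ := g.eq_one_or_eq_gxx_or_isTuple
    · exact one
    · exact gxx
    · have h1 := ht.height_eq
      have h2 := ht.height_left
      have h3 := ht.height_right
      exact tuple _ _ _ _ _ _ ht (ih l.height (by omega) l rfl) (ih r.height (by omega) r rfl)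

@[simp] theorem lastOf_ascent (g : Vertex) : lastOf one g.1.ascent = g := by
  induction g using middle_induction with
  | one => rfl
  | gxx => simp
  | tuple g l la c ra r h ih => simp [h.ascent_eq]

@[simp] theorem lastOf_descent (g : Vertex) : lastOf g g.1.descent = one := by
  induction g using middle_induction with
  | one => rfl
  | gxx => simp
  | tuple g l la c ra r h ih => simp [h.descent_eq, ih]

theorem rises_ascent (g : Vertex) : Rises one g.1.ascent := by
  induction g using middle_induction with
  | one => trivial
  | gxx => simpa [Along] using one_up_gxx
  | tuple g l la c ra r h ih =>
    rw [h.ascent_eq]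
    refine along_append.2 ⟨ih, ?_⟩
    simpa [Along] using ⟨h.up_left, h.up_iff.2 (Or.inl ⟨rfl, rfl⟩)⟩

theorem falls_descent (g : Vertex) : Falls g g.1.descent := by
  induction g using middle_induction with
  | one => trivial
  | gxx =>
    rw [descent_gxx]
    exact ⟨one_up_gxx, trivial⟩
  | tuple g l la c ra r h ih =>
    rw [h.descent_eq]
    refine along_append.2 ⟨⟨h.up_iff.2 (Or.inr ⟨by simp, by simp⟩), h.up_right, trivial⟩, ?_⟩
    simpa using ih

theorem IsTuple.step {g l c r : Vertex} {la ra : Anchor} (h : IsTuple g l la c ra r)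
    (q : List (Anchor × Vertex)) :
    Step r ((ra, c) :: (la.inv, l) :: q) ((ra, g) :: (la.inv, l) :: q) :=
  .lift (by simp) h q

/-- Both canonical hills pass through the middle entry `c`. By induction the valley below `c`
disappears, leaving `g r c l g`; lifting `c` produces `g` itself, and then `r` and `l` cancel. -/
theorem steps_descent_ascent (g : Vertex) : Steps g (g.1.descent ++ g.1.ascent) [] := by
  induction g using middle_induction with
  | one => exact .refl
  | gxx =>
    rw [descent_gxx, ascent_gxx]
    exact .single (.cancel rfl one_up_gxx [])
  | tuple g l la c ra r h ih =>
    have h1 := ih.between (f := g) [(ra.inv, r), (ra, c)] [(la.inv, l), (la, g)] rfl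
    rw [h.descent_eq, h.ascent_eq]
    simp only [List.append_assoc] at h1 ⊢
    refine h1.trans ?_
    refine .head (.cons _ (h.step _)) (.head (.cancel (by simp) (h.up_iff.2 (Or.inr ⟨rfl, rfl⟩)) _)
      (.single (.cancel (by simp) (h.up_iff.2 (Or.inl ⟨rfl, rfl⟩)) _)))

/-- Going down to `1`, around the loop of an anchor and up again amounts to the single anchored
step. The induction runs over side entries because the canonical hills of `g` reach `c` through `l`
or `r`: the hypothesis contracts the part between `c` and that side, and at most one lift and one
cancellation remain. -/
theorem steps_of_up (g : Vertex) : ∀ (h : Vertex) (a : Anchor), h.Up a g →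
    Steps h (h.1.descent ++ (Letter.anchor a).loop ++ g.1.ascent) [(a, g)] ∧
    Steps g (g.1.descent ++ (Letter.anchor a.inv).loop ++ h.1.ascent) [(a.inv, h)] := by
  induction g using side_induction with
  | one => exact fun _ _ h => (not_up_one h).elim
  | gxx =>
    intro h a ha
    obtain ⟨rfl, rfl | rfl⟩ := up_gxx_iff.1 ha
    · simpa [Letter.loop, Anchor.inv] using And.intro ReflTransGen.refl ReflTransGen.refl
    · simp only [descent_one, ascent_gxx, descent_gxx, ascent_one, Letter.loop, Anchor.inv]
      exact ⟨.single (.cons _ (.cancel rfl one_up_gxx [])), .single (.cancel rfl one_up_gxx _)⟩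
  | tuple g l la c ra r ht ihl ihr =>
    intro h a ha
    have hl : l.Up la g := ht.up_iff.2 (Or.inl ⟨rfl, rfl⟩)
    have hr : r.Up ra g := ht.up_iff.2 (Or.inr ⟨rfl, rfl⟩)
    have h1 := (ihl c _ ht.up_left).2
    have h2 := (ihl c _ ht.up_left).1
    have h3 := (ihr c _ ht.up_right).2
    have h4 := (ihr c _ ht.up_right).1
    rw [Anchor.inv_inv] at h1 h3
    rw [ht.ascent_eq, ht.descent_eq]
    rcases ht.up_iff.1 ha with ⟨rfl, rfl⟩ | ⟨rfl, rfl⟩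
    · constructor
      · have h5 := h1.append_right [(a.inv, h), (a, g)]
        simp only [List.append_assoc] at h5 ⊢
        exact h5.trans (.single (.cancel rfl ht.up_left _))
      · have h5 := h2.append_left (f := g) [(ra.inv, r), (ra, c)] rfl
        simp only [List.append_assoc] at h5 ⊢
        exact h5.trans (.head (.cons _ (ht.step _)) (.single (.cancel (by simp) hr _)))
    · constructor
      · have h5 := h3.append_right [(la.inv, l), (la, g)]
        simp only [List.append_assoc] at h5 ⊢
        exact h5.trans (.head (ht.step _) (.single (.cons _ (.cancel (by simp) hl _))))
      · have h5 := h4.append_left (f := g) [(a.inv, h), (a, c)] rfl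
        simp only [List.append_assoc] at h5 ⊢
        exact h5.trans (.single (.cons _ (.cancel rfl ht.up_right _)))

theorem steps_of_anchored {g h : Vertex} {a : Anchor} (ha : Anchored g a h) :
    Steps g (g.1.descent ++ (Letter.anchor a).loop ++ h.1.ascent) [(a, h)] := by
  obtain ha | ha := anchored_iff.1 ha
  · exact (h.steps_of_up g a ha).1
  · simpa using (g.steps_of_up h _ ha).2

end Vertex

/-! ### Evaluation of words as mountains -/

/-- The word obtained by replacing each generator by a mountain. -/
noncomputable def evalSteps (w : FreeSemigroup Gen) : List (Anchor × Vertex) :=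
  (w.head :: w.tail).flatMap fun g => g.1.loop

theorem evalSteps_mul (v w : FreeSemigroup Gen) :
    evalSteps (v * w) = evalSteps v ++ evalSteps w := by
  simp [evalSteps]

theorem evalSteps_of (g : Gen) : evalSteps (.of g) = g.1.loop := by
  simp [evalSteps, FreeSemigroup.of]

@[simp] theorem Anchor.gen_val (a : Anchor) : a.gen.1 = .anchor a := rfl

@[simp] theorem Vertex.gen_val (g : Vertex) : g.gen.1 = g.1 := rfl

theorem Letter.lastOf_loop_anchor (a : Anchor) :
    lastOf Vertex.one (Letter.anchor a).loop = Vertex.one := by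
  cases a <;> simp [Letter.loop]

theorem Gen.lastOf_loop (g : Gen) : lastOf Vertex.one g.1.loop = Vertex.one := by
  obtain ⟨g, ⟨a, rfl⟩ | h⟩ := g
  · exact Letter.lastOf_loop_anchor a
  · have key : ∀ v : Vertex, lastOf Vertex.one v.1.loop = Vertex.one := fun v => by
      rw [v.loop_val]
      simp
    exact key ⟨g, Or.inr h⟩

theorem lastOf_evalSteps (w : FreeSemigroup Gen) :
    lastOf Vertex.one (evalSteps w) = Vertex.one := by
  induction w using FreeSemigroup.recOnMul with
  | ih1 g => rw [evalSteps_of, g.lastOf_loop]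
  | ih2 g w h1 h2 => rw [evalSteps_mul, lastOf_append, h1, h2]

/-- The congruence of having the same mountain. -/
def evalCon : Con (FreeSemigroup Gen) where
  r v w := Joinable Vertex.one (evalSteps v) (evalSteps w)
  iseqv := ⟨fun _ => .refl _ _, fun h => h.symm, fun h h' => h.trans h'⟩
  mul' {w x y z} h h' := by
    rw [evalSteps_mul, evalSteps_mul]
    exact h.append (lastOf_evalSteps _) h'

theorem Steps.reduce_mountain_product {g h : Vertex} {a : Anchor}
    (ha : Anchored g a h) (p q : List (Anchor × Vertex)) (hp : lastOf Vertex.one p = g) :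
    Steps Vertex.one (p ++ (g.1.descent ++ ((Letter.anchor a).loop ++ (h.1.ascent ++ q))))
      (p ++ (a, h) :: q) := by
  simpa using (Vertex.steps_of_anchored ha).between p q hp

/-- Canonical hills are built to mirror the relations `left` and `right`, which therefore reduce to
the loop of `g`; `sq` is the contraction of the canonical valley, and `middle` is the lifting of `c`
to `g` between `r` and `l`. -/
theorem Rel.joinable {v w : FreeSemigroup Gen} (h : Rel v w) :
    Joinable Vertex.one (evalSteps v) (evalSteps w) := by
  cases h with
  | x_x'_x =>
    simp only [evalSteps_mul, evalSteps_of, Anchor.gen_val, Letter.loop]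
    exact Steps.joinable (.head (.cons _ (.cancel rfl Vertex.one_up_gxx' _))
      (.single (.cons _ (.cancel rfl Vertex.one_up_gxx _))))
  | x'_x_x' =>
    simp only [evalSteps_mul, evalSteps_of, Anchor.gen_val, Letter.loop]
    exact Steps.joinable (.head (.cons _ (.cancel rfl Vertex.one_up_gxx _))
      (.single (.cons _ (.cancel rfl Vertex.one_up_gxx' _))))
  | gxx =>
    rw [evalSteps_mul, evalSteps_of, evalSteps_of, evalSteps_of, Vertex.gen_val, Vertex.loop_val,
      Vertex.ascent_gxx, Vertex.descent_gxx]
    exact (Steps.joinable (.single (.cons _ (.cancel rfl Vertex.one_up_gxx' _)))).symm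
  | one_mul g =>
    simpa [evalSteps_mul, evalSteps_of, Letter.loop] using Joinable.refl _ _
  | mul_one g =>
    simpa [evalSteps_mul, evalSteps_of, Letter.loop] using Joinable.refl _ _
  | sq g =>
    simp only [evalSteps_mul, evalSteps_of, Vertex.gen_val, Vertex.loop_val]
    simpa using (g.steps_descent_ascent.between (f := Vertex.one) g.1.ascent g.1.descent
      (by simp)).joinable
  | left g l c r la ra hg h2 =>
    have h := Vertex.isTuple_of_eq hg
    simp only [evalSteps_mul, evalSteps_of, Vertex.gen_val, Anchor.gen_val, Vertex.loop_val,
      List.append_assoc]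
    have h1 := Steps.reduce_mountain_product (Or.inl h.up_left) c.1.ascent
      (l.1.descent ++ ((Letter.anchor la).loop ++ (g.1.ascent ++ g.1.descent))) (by simp)
    have h2 := Steps.reduce_mountain_product (Or.inl (h.up_iff.2 (Or.inl ⟨rfl, rfl⟩)))
      (c.1.ascent ++ [(la.inv, l)]) g.1.descent (by simp)
    refine Steps.joinable (h1.trans ?_)
    have h3 : c.1.ascent ++ [(la.inv, l)] ++ (la, g) :: g.1.descent =
        g.1.ascent ++ g.1.descent := by
      rw [h.ascent_eq]
      simp
    rw [h3] at h2
    simpa using h2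
  | right g l c r la ra hg h2 =>
    have h := Vertex.isTuple_of_eq hg
    simp only [evalSteps_mul, evalSteps_of, Vertex.gen_val, Anchor.gen_val, Vertex.loop_val,
      List.append_assoc]
    have h1 := Steps.reduce_mountain_product (a := ra.inv)
      (Or.inr (h.up_iff.2 (Or.inr ⟨rfl, by simp⟩))) g.1.ascent
      (r.1.descent ++ ((Letter.anchor ra).loop ++ (c.1.ascent ++ c.1.descent))) (by simp)
    have h2 := Steps.reduce_mountain_product (a := ra) (Or.inr h.up_right)
      (g.1.ascent ++ [(ra.inv, r)]) c.1.descent (by simp)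
    refine Steps.joinable (h1.trans ?_)
    have h3 : g.1.ascent ++ [(ra.inv, r)] ++ (ra, c) :: c.1.descent =
        g.1.ascent ++ g.1.descent := by
      rw [h.descent_eq]
      simp
    rw [h3] at h2
    simpa using h2
  | middle g l c r la ra hg h2 =>
    have h := Vertex.isTuple_of_eq hg
    simp only [evalSteps_mul, evalSteps_of, Vertex.gen_val, Anchor.gen_val, Vertex.loop_val,
      List.append_assoc]
    have h1 := Steps.reduce_mountain_product (Or.inl (h.up_iff.2 (Or.inr ⟨rfl, rfl⟩))) r.1.ascent
      (g.1.descent ++ ((Letter.anchor la.inv).loop ++ (l.1.ascent ++ l.1.descent))) (by simp)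
    have h2 := Steps.reduce_mountain_product (a := la.inv)
      (Or.inr (h.up_iff.2 (Or.inl ⟨rfl, by simp⟩)))
      (r.1.ascent ++ [(ra, g)]) l.1.descent (by simp)
    have h3 := Steps.reduce_mountain_product (a := ra) (Or.inr h.up_right) r.1.ascent
      (c.1.descent ++ ((Letter.anchor la.inv).loop ++ (l.1.ascent ++ l.1.descent))) (by simp)
    have h4 := Steps.reduce_mountain_product (Or.inl h.up_left)
      (r.1.ascent ++ [(ra, c)]) l.1.descent (by simp)
    have h5 := Steps.append_left (f := Vertex.one) r.1.ascent (by simp)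
      (.single (h.step l.1.descent))
    refine ⟨r.1.ascent ++ (ra, g) :: (la.inv, l) :: l.1.descent, h1.trans (by simpa using h2),
      h3.trans (.trans (by simpa using h4) h5)⟩

theorem conGen_le_evalCon : conGen Rel ≤ evalCon := Con.conGen_le.2 fun _ _ h => h.joinable

/-- For a mountain both end letters are `1`, whose canonical hills are empty, so evaluation returns
the mountain itself. -/
theorem steps_evalSteps_word {f : Vertex} {s : List (Anchor × Vertex)} (hs : Land f s) :
    Steps Vertex.one (evalSteps (word ⟨f, s⟩))
      (f.1.ascent ++ s ++ (lastOf f s).1.descent) := by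
  induction s generalizing f with
  | nil =>
    simpa [evalSteps, word, Vertex.loop_val] using ReflTransGen.refl
  | cons x s ih =>
    obtain ⟨a, g⟩ := x
    have h1 := (ih hs.2).append_left (f := Vertex.one)
      (f.1.loop ++ (Letter.anchor a).loop)
      (by rw [lastOf_append, f.loop_val, lastOf_append, f.lastOf_ascent, f.lastOf_descent,
        Letter.lastOf_loop_anchor])
    have h2 := Steps.reduce_mountain_product hs.1 f.1.ascent (s ++ (lastOf g s).1.descent)
      (by simp)
    have h3 : evalSteps (word ⟨f, (a, g) :: s⟩) =
        f.1.loop ++ (Letter.anchor a).loop ++ evalSteps (word ⟨g, s⟩) := by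
      simp [evalSteps, word]
    rw [h3]
    refine h1.trans ?_
    simpa [Vertex.loop_val] using h2

/-! ### The product of mountains and the injectivity of `cls` -/

namespace Mountain

theorem start_eq (u : Mountain) : u.1.start = Vertex.one := (isMountain_iff.1 u.2).1

theorem hill (u : Mountain) : Hill Vertex.one u.1.steps := (isMountain_iff.1 u.2).2.1

theorem lastOf_steps (u : Mountain) : lastOf Vertex.one u.1.steps = Vertex.one :=
  (isMountain_iff.1 u.2).2.2

theorem eq_mk (u : Mountain) : u.1 = ⟨Vertex.one, u.1.steps⟩ := AltWord.ext u.start_eq rfl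

theorem ext_steps {u v : Mountain} (h : u.1.steps = v.1.steps) : u = v :=
  Subtype.ext (AltWord.ext (u.start_eq.trans v.start_eq.symm) h)

theorem eq_of_joinable {u v : Mountain} (h : Joinable Vertex.one u.1.steps v.1.steps) : u = v :=
  ext_steps (u.hill.eq_of_joinable v.hill h)

/-- Every landscape from `1` to `1` reduces to a mountain. -/
theorem exists_steps {s : List (Anchor × Vertex)} (hs : Land Vertex.one s)
    (h : lastOf Vertex.one s = Vertex.one) : ∃ w : Mountain, Steps Vertex.one s w.1.steps := by
  obtain ⟨t, ht, hst⟩ := exists_steps_hill hs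
  exact ⟨⟨⟨Vertex.one, t⟩, isMountain_iff.2 ⟨rfl, ht, hst.lastOf_eq ▸ h⟩⟩, hst⟩

theorem mul_steps (u v : Mountain) :
    Steps Vertex.one (u.1.steps ++ v.1.steps) (u * v).1.steps := by
  have hl : Land Vertex.one (u.1.steps ++ v.1.steps) :=
    along_append.2 ⟨u.hill.land, by rw [u.lastOf_steps]; exact v.hill.land⟩
  have key : ∀ w : Mountain, UpliftStar (u.1.star v.1) w.1 ↔
      Steps Vertex.one (u.1.steps ++ v.1.steps) w.1.steps := by
    intro w
    change UpliftStar ⟨u.1.start, u.1.steps ++ v.1.steps⟩ w.1 ↔ _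
    rw [u.start_eq, upliftStar_iff hl, and_iff_right w.start_eq]
  obtain ⟨w, hw⟩ := exists_steps hl (by rw [lastOf_append, u.lastOf_steps, v.lastOf_steps])
  exact (key _).1 (Classical.epsilon_spec (p := fun w : Mountain => UpliftStar (u.1.star v.1) w.1)
    ⟨w, (key w).2 hw⟩)

theorem mul_eq_iff {u v w : Mountain} :
    u * v = w ↔ Joinable Vertex.one (u.1.steps ++ v.1.steps) w.1.steps := by
  have h := (mul_steps u v).joinable
  refine ⟨?_, fun hw => eq_of_joinable (h.symm.trans hw)⟩
  rintro rfl
  exact h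

theorem cls_injective : Function.Injective cls := by
  intro u v h
  have h1 : Joinable _ _ _ := conGen_le_evalCon (Con.eq _ |>.1 h)
  have key : ∀ w : Mountain, Steps Vertex.one (evalSteps w.1.word) w.1.steps := by
    intro w
    have := steps_evalSteps_word w.hill.land
    rw [← w.eq_mk, w.lastOf_steps] at this
    simpa using this
  exact eq_of_joinable ((key u).joinable.symm.trans (h1.trans (key v).joinable))

end Mountain

/-! ### Mountains represent all elements of the presented monoid -/

/-- The class of a generator. -/
def Gen.cls (g : Gen) : FOne := ((FreeSemigroup.of g : FreeSemigroup Gen) : (conGen Rel).Quotient)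

instance : Semigroup FOne where
  mul_assoc a b c := by
    induction a, b using Con.induction_on₂ with
    | _ a b =>
      induction c using Con.induction_on with
      | _ c => exact congrArg _ (mul_assoc a b c)

theorem Rel.coe_eq {v w : FreeSemigroup Gen} (h : Rel v w) : (v : (conGen Rel).Quotient) = w :=
  (Con.eq _).2 (ConGen.Rel.of _ _ h)

/-- The class of a word. -/
def pathCls (f : Vertex) (s : List (Anchor × Vertex)) : FOne :=
  (word ⟨f, s⟩ : (conGen Rel).Quotient)

theorem pathCls_nil (f : Vertex) : pathCls f [] = f.gen.cls := rfl

theorem pathCls_cons (f g : Vertex) (a : Anchor) (s : List (Anchor × Vertex)) :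
    pathCls f ((a, g) :: s) = f.gen.cls * (a.gen.cls * pathCls g s) := rfl

theorem Vertex.cls_mul_self (g : Vertex) : g.gen.cls * g.gen.cls = g.gen.cls := (Rel.sq g).coe_eq

theorem one_mul_cls (g : Gen) : Anchor.one.gen.cls * g.cls = g.cls := (Rel.one_mul g).coe_eq

theorem cls_mul_one (g : Gen) : g.cls * Anchor.one.gen.cls = g.cls := (Rel.mul_one g).coe_eq

theorem cls_mul_pathCls (f : Vertex) (s : List (Anchor × Vertex)) :
    f.gen.cls * pathCls f s = pathCls f s := by
  cases s with
  | nil => exact f.cls_mul_self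
  | cons x s => rw [pathCls_cons, ← mul_assoc, f.cls_mul_self]

theorem pathCls_append (f : Vertex) (s t : List (Anchor × Vertex)) :
    pathCls f (s ++ t) = pathCls f s * pathCls (lastOf f s) t := by
  induction s generalizing f with
  | nil => exact (cls_mul_pathCls f t).symm
  | cons x s ih =>
    obtain ⟨a, g⟩ := x
    rw [List.cons_append, pathCls_cons, pathCls_cons, ih, lastOf_cons, mul_assoc, mul_assoc]

namespace Vertex

theorem gxx_cls : gxx.gen.cls = Anchor.x.gen.cls * Anchor.x'.gen.cls := Rel.gxx.coe_eq

section IsTuple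

variable {g l c r : Vertex} {la ra : Anchor}

theorem IsTuple.middle_mul_cls (h : IsTuple g l la c ra r) :
    c.gen.cls * (la.inv.gen.cls * (l.gen.cls * (la.gen.cls * g.gen.cls))) = g.gen.cls := by
  have := (Rel.left g l c r la ra h.eq (by have := h.height_eq; have := h.height_left; omega)).coe_eq
  simp only [Con.coe_mul, mul_assoc] at this
  exact this

theorem IsTuple.cls_mul_middle (h : IsTuple g l la c ra r) :
    g.gen.cls * (ra.inv.gen.cls * (r.gen.cls * (ra.gen.cls * c.gen.cls))) = g.gen.cls := by
  have := (Rel.right g l c r la ra h.eq (by have := h.height_eq; have := h.height_left; omega)).coe_eq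
  simp only [Con.coe_mul, mul_assoc] at this
  exact this

theorem IsTuple.side_mul_cls_mul_side (h : IsTuple g l la c ra r) :
    r.gen.cls * (ra.gen.cls * (g.gen.cls * (la.inv.gen.cls * l.gen.cls))) =
      r.gen.cls * (ra.gen.cls * (c.gen.cls * (la.inv.gen.cls * l.gen.cls))) := by
  have := (Rel.middle g l c r la ra h.eq
    (by have := h.height_eq; have := h.height_left; omega)).coe_eq
  simp only [Con.coe_mul, mul_assoc] at this
  exact this

theorem IsTuple.middle_mul (h : IsTuple g l la c ra r) :
    c.gen.cls * g.gen.cls = g.gen.cls := by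
  conv_lhs => rw [← h.middle_mul_cls, ← mul_assoc, c.cls_mul_self, h.middle_mul_cls]

theorem IsTuple.mul_middle (h : IsTuple g l la c ra r) :
    g.gen.cls * c.gen.cls = g.gen.cls := by
  conv_lhs => rw [← h.cls_mul_middle]
  simp only [mul_assoc]
  rw [c.cls_mul_self, h.cls_mul_middle]

end IsTuple

/-- This is the cancelling rule read in the presented monoid. On the left side it is the relation
`left` multiplied by `f`, using `f c = f`; on the right side, `right` multiplied by `f`, using `c f
= f`. At `gxx` it follows from idempotency and `gxx = x x'`. -/
theorem cls_sandwich {f g : Vertex} {a : Anchor} (h : g.Up a f) :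
    f.gen.cls * (a.inv.gen.cls * (g.gen.cls * (a.gen.cls * f.gen.cls))) = f.gen.cls := by
  obtain rfl | rfl | ⟨l, la, c, ra, r, ht⟩ := f.eq_one_or_eq_gxx_or_isTuple
  · exact (not_up_one h).elim
  · have h1 := gxx.cls_mul_self
    obtain ⟨rfl, rfl | rfl⟩ := up_gxx_iff.1 h
    · change gxx.gen.cls * (Anchor.one.gen.cls * (Anchor.one.gen.cls *
        (Anchor.one.gen.cls * gxx.gen.cls))) = _
      rw [one_mul_cls, one_mul_cls, one_mul_cls, h1]
    · change gxx.gen.cls * (Anchor.x.gen.cls * (Anchor.one.gen.cls *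
        (Anchor.x'.gen.cls * gxx.gen.cls))) = _
      rw [← mul_assoc Anchor.one.gen.cls, one_mul_cls, ← mul_assoc Anchor.x.gen.cls, ← gxx_cls,
        h1, h1]
  · rcases ht.up_iff.1 h with ⟨rfl, rfl⟩ | ⟨rfl, rfl⟩
    · conv_lhs => rw [← ht.mul_middle, mul_assoc]
      rw [ht.mul_middle, ht.middle_mul_cls, f.cls_mul_self]
    · have := congrArg (· * f.gen.cls) ht.cls_mul_middle
      simp only [mul_assoc, f.cls_mul_self, ht.middle_mul] at this
      exact this

theorem pathCls_ascent (g : Vertex) : pathCls one g.1.ascent = g.gen.cls := by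
  induction g using middle_induction with
  | one => rfl
  | gxx =>
    rw [ascent_gxx, pathCls_cons, pathCls_nil, one_mul_cls]
    exact one_mul_cls _
  | tuple g l la c ra r h ih =>
    rw [h.ascent_eq, pathCls_append, ih, lastOf_ascent, cls_mul_pathCls]
    exact h.middle_mul_cls

theorem pathCls_descent (g : Vertex) : pathCls g g.1.descent = g.gen.cls := by
  induction g using middle_induction with
  | one => rfl
  | gxx =>
    rw [descent_gxx, pathCls_cons, pathCls_nil, one_mul_cls]
    exact cls_mul_one _
  | tuple g l la c ra r h ih =>
    rw [h.descent_eq, pathCls_append]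
    change pathCls g _ * pathCls c _ = _
    rw [ih, pathCls_cons, pathCls_cons, pathCls_nil]
    simp only [mul_assoc]
    rw [c.cls_mul_self, h.cls_mul_middle]

end Vertex

/-- Cancelling is `cls_sandwich` and lifting is the relation `middle`; idempotency of letters
supplies the extra copies at the junctions. -/
theorem AltWord.Step.pathCls_eq {f : Vertex} {s t : List (Anchor × Vertex)} (h : Step f s t) :
    pathCls f s = pathCls f t := by
  induction h with
  | @cancel f g a b hb hf q =>
    subst hb
    rw [← cls_mul_pathCls f q]
    conv_rhs => rw [← Vertex.cls_sandwich hf, Anchor.inv_inv]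
    simp only [pathCls_cons, mul_assoc, cls_mul_pathCls]
  | @lift f g k n a b c hc hn q =>
    subst hc
    have h := congrArg (· * pathCls k q) hn.side_mul_cls_mul_side
    simp only [mul_assoc, cls_mul_pathCls, Anchor.inv_inv] at h
    exact h.symm
  | cons a h ih => rw [pathCls_cons, pathCls_cons, ih]

theorem AltWord.Steps.pathCls_eq {f : Vertex} {s t : List (Anchor × Vertex)} (h : Steps f s t) :
    pathCls f s = pathCls f t := by
  induction h with
  | refl => rfl
  | tail _ h ih => exact ih.trans h.pathCls_eq

theorem exists_pathCls (z : FOne) : ∃ s, Land Vertex.one s ∧ lastOf Vertex.one s = Vertex.one ∧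
    pathCls Vertex.one s = z := by
  induction z using Con.induction_on with
  | _ w =>
    induction w using FreeSemigroup.recOnMul with
    | ih1 g =>
      have key : ∀ g : Vertex, ∃ s, Land Vertex.one s ∧ lastOf Vertex.one s = Vertex.one ∧
          pathCls Vertex.one s = g.gen.cls := by
        intro g
        refine ⟨g.1.ascent ++ g.1.descent, along_append.2 ⟨g.rises_ascent.land, ?_⟩, by simp, ?_⟩
        · rw [g.lastOf_ascent]
          exact g.falls_descent.land
        · rw [pathCls_append, g.lastOf_ascent, g.pathCls_ascent, g.pathCls_descent,
            g.cls_mul_self]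
      obtain ⟨g, ⟨a, rfl⟩ | h⟩ := g
      · cases a with
        | one => exact key Vertex.one
        | x =>
          refine ⟨[(.one, Vertex.gxx), (.x, Vertex.one)],
            ⟨Or.inl Vertex.one_up_gxx, Or.inr Vertex.one_up_gxx', trivial⟩, rfl, ?_⟩
          change Anchor.one.gen.cls * (Anchor.one.gen.cls * (Vertex.gxx.gen.cls *
            (Anchor.x.gen.cls * Anchor.one.gen.cls))) = Anchor.x.gen.cls
          rw [cls_mul_one, Vertex.gxx_cls,
            show Anchor.x.gen.cls * Anchor.x'.gen.cls * Anchor.x.gen.cls = Anchor.x.gen.cls from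
              Rel.x_x'_x.coe_eq, one_mul_cls, one_mul_cls]
        | x' =>
          refine ⟨[(.x', Vertex.gxx), (.one, Vertex.one)],
            ⟨Or.inl Vertex.one_up_gxx', Or.inr Vertex.one_up_gxx, trivial⟩, rfl, ?_⟩
          change Anchor.one.gen.cls * (Anchor.x'.gen.cls * (Vertex.gxx.gen.cls *
            (Anchor.one.gen.cls * Anchor.one.gen.cls))) = Anchor.x'.gen.cls
          rw [cls_mul_one, cls_mul_one, Vertex.gxx_cls, ← mul_assoc Anchor.x'.gen.cls,
            show Anchor.x'.gen.cls * Anchor.x.gen.cls * Anchor.x'.gen.cls = Anchor.x'.gen.cls from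
              Rel.x'_x_x'.coe_eq, one_mul_cls]
      · exact key ⟨g, Or.inr h⟩
    | ih2 g w h1 h2 =>
      obtain ⟨s, hs, hs1, hs2⟩ := h1
      obtain ⟨t, ht, ht1, ht2⟩ := h2
      refine ⟨s ++ t, along_append.2 ⟨hs, by rwa [hs1]⟩, by rw [lastOf_append, hs1, ht1], ?_⟩
      rw [pathCls_append, hs1, hs2, ht2]
      rfl

namespace Mountain

theorem cls_eq (u : Mountain) : u.cls = pathCls Vertex.one u.1.steps := by
  rw [pathCls, ← u.eq_mk, cls]

theorem cls_mul (u v : Mountain) : (u * v).cls = u.cls * v.cls := by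
  rw [cls_eq, cls_eq, cls_eq, ← (mul_steps u v).pathCls_eq, pathCls_append, u.lastOf_steps]

theorem cls_surjective : Function.Surjective cls := by
  intro z
  obtain ⟨s, hs, h1, rfl⟩ := exists_pathCls z
  obtain ⟨w, hw⟩ := exists_steps hs h1
  exact ⟨w, by rw [cls_eq, hw.pathCls_eq]⟩

end Mountain

end FreeRegular

/-! ### Loops at a peak, gorges and reversed paths -/

namespace FreeRegular

open Relation

namespace AltWord

theorem Rises.height_lastOf {f : Vertex} {p : List (Anchor × Vertex)} (hp : Rises f p) :
    (lastOf f p).height = f.height + p.length := by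
  induction p generalizing f with
  | nil => rfl
  | cons x p ih =>
    rw [lastOf_cons, ih hp.2, Vertex.Up.height_eq hp.1, List.length_cons]
    omega

theorem Falls.height_lastOf {f : Vertex} {d : List (Anchor × Vertex)} (hd : Falls f d) :
    f.height = (lastOf f d).height + d.length := by
  induction d generalizing f with
  | nil => rfl
  | cons x d ih =>
    rw [lastOf_cons, Down.height_eq hd.1, ih hd.2, List.length_cons]
    omega

theorem hill_append {f g : Vertex} {p d : List (Anchor × Vertex)} (hp : Rises f p)
    (hg : lastOf f p = g) (hd : Falls g d) : Hill f (p ++ d) :=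
  ⟨p, d, rfl, hp, hg ▸ hd⟩

/-- A loop at the peak which is absorbed by a hill is trivial. -/
theorem joinable_nil_of_absorbed {f k : Vertex} {p w d : List (Anchor × Vertex)} (hp : Rises f p)
    (hk : lastOf f p = k) (hd : Falls k d) (hw : Land k w) (hwk : lastOf k w = k)
    (h : Joinable f (p ++ w ++ d) (p ++ d)) : Joinable k w [] := by
  subst hk
  obtain ⟨p', d', hp', hd', hl, hj⟩ := Steps.exists_joinable hw
  -- Once `w` is replaced by its normal form `p' d'`, the whole word rises along `p p'` and falls
  -- along `d' d`, so it is already irreducible and must equal `p d`.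
  have h1 : Hill f ((p ++ p') ++ (d' ++ d)) :=
    hill_append (along_append.2 ⟨hp, hp'⟩) (by simp)
      (along_append.2 ⟨hd', by rwa [hl, hwk]⟩)
  have h2 := (hj.between p d rfl).symm.trans h
  have h3 := h1.eq_of_joinable (hill_append hp rfl hd) (by simpa using h2)
  have h4 := congrArg List.length h3
  simp only [List.length_append] at h4
  obtain rfl : p' = [] := List.length_eq_zero_iff.1 (by omega)
  obtain rfl : d' = [] := List.length_eq_zero_iff.1 (by omega)
  exact hj

/-- Rivers occur only in the inner valley `d₁ p₂`. Its normal form fits between `p₁` and `d₂` to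
give a hill, and a hill equivalent to the empty path is empty. -/
theorem eq_nil_of_joinable_nil {k m : Vertex} {p₁ d₁ p₂ d₂ : List (Anchor × Vertex)}
    (hp₁ : Rises k p₁) (hd₁ : Falls (lastOf k p₁) d₁) (hm : lastOf k (p₁ ++ d₁) = m)
    (hp₂ : Rises m p₂) (hd₂ : Falls (lastOf m p₂) d₂)
    (h : Joinable k ((p₁ ++ d₁) ++ (p₂ ++ d₂)) []) : p₁ = [] ∧ d₂ = [] := by
  subst hm
  rw [lastOf_append] at hp₂ hd₂
  obtain ⟨p, d, hp, hd, hl, hj⟩ := Steps.exists_joinable (along_append.2 ⟨hd₁.land, hp₂.land⟩)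
  have h1 : Hill k ((p₁ ++ p) ++ (d ++ d₂)) :=
    hill_append (along_append.2 ⟨hp₁, hp⟩) (by simp)
      (along_append.2 ⟨hd, by rwa [hl, lastOf_append]⟩)
  have h2 := (hj.between p₁ d₂ rfl).symm.trans (by simpa using h)
  have h3 := h1.eq_of_joinable (Rises.hill (f := k) (s := []) trivial) (by simpa using h2)
  simp_all

/-- If `d` or `p` is empty the word is a hill, hence empty when equivalent to the empty path: this
is the trivial canyon. Otherwise it is a genuine valley. -/
theorem isGorge_iff {k m : Vertex} {d p : List (Anchor × Vertex)} (hd : Falls k d)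
    (hm : lastOf k d = m) (hp : Rises m p) :
    IsGorge ⟨k, d ++ p⟩ ↔ Joinable k (d ++ p) [] := by
  have hnil : Hill k [] := Rises.hill (f := k) (s := []) trivial
  have hl : Land k (d ++ p) := along_append.2 ⟨hd.land, hm ▸ hp.land⟩
  refine ⟨fun h => Steps.joinable ((upliftStar_iff hl).1 h.2).2, fun h => ⟨⟨?_, ?_⟩,
    (upliftStar_iff hl).2 ⟨rfl, hnil.steps_of_joinable h⟩⟩⟩
  · rcases eq_or_ne d [] with rfl | hd0
    · obtain rfl : k = m := hm
      exact Or.inr ((Rises.hill hp).eq_of_joinable hnil h)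
    rcases eq_or_ne p [] with rfl | hp0
    · exact Or.inr (Hill.eq_of_joinable (by simpa using Falls.hill hd) hnil h)
    exact Or.inl ⟨⟨k, d⟩, ⟨m, p⟩, isDownhill_iff.2 ⟨hd, hd0⟩, isUphill_iff.2 ⟨hp, hp0⟩, hm, rfl⟩
  · exact h.lastOf_eq.symm

/-- The reverse path, from the last letter to the first. -/
def reversal : Vertex → List (Anchor × Vertex) → List (Anchor × Vertex)
  | _, [] => []
  | f, (a, g) :: s => reversal g s ++ [(a.inv, f)]

theorem lastOf_reversal (f : Vertex) (s : List (Anchor × Vertex)) :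
    lastOf (lastOf f s) (reversal f s) = f := by
  induction s generalizing f with
  | nil => rfl
  | cons x s ih => simp [reversal]

theorem Rises.reversal {f : Vertex} {p : List (Anchor × Vertex)} (hp : Rises f p) :
    Falls (lastOf f p) (reversal f p) := by
  induction p generalizing f with
  | nil => trivial
  | cons x p ih =>
    rw [lastOf_cons]
    refine along_append.2 ⟨ih hp.2, ?_⟩
    rw [lastOf_reversal]
    refine ⟨?_, trivial⟩
    simpa [Down] using hp.1

theorem Falls.reversal {f : Vertex} {d : List (Anchor × Vertex)} (hd : Falls f d) :
    Rises (lastOf f d) (reversal f d) := by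
  induction d generalizing f with
  | nil => trivial
  | cons x d ih =>
    rw [lastOf_cons]
    refine along_append.2 ⟨ih hd.2, ?_⟩
    rw [lastOf_reversal]
    exact ⟨hd.1, trivial⟩

theorem Rises.joinable_reversal {f : Vertex} {p : List (Anchor × Vertex)} (hp : Rises f p) :
    Joinable (lastOf f p) (AltWord.reversal f p ++ p) [] := by
  induction p generalizing f with
  | nil => exact .refl _ _
  | cons x p ih =>
    have h1 : Steps x.2 ([(x.1.inv, f), x]) [] := .single (.cancel (by simp) hp.1 _)
    have h2 := (h1.between (f := lastOf x.2 p) (AltWord.reversal x.2 p) p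
      (lastOf_reversal _ _)).joinable
    rw [lastOf_cons]
    refine Joinable.trans ?_ (ih hp.2)
    simpa [AltWord.reversal] using h2

theorem Falls.joinable_reversal {f : Vertex} {d : List (Anchor × Vertex)} (hd : Falls f d) :
    Joinable f (d ++ AltWord.reversal f d) [] := by
  induction d generalizing f with
  | nil => exact .refl _ _
  | cons x d ih =>
    have h1 : Steps f ([x, (x.1.inv, f)]) [] := .single (.cancel rfl hd.1 _)
    have h2 := (ih hd.2).between (f := f) [x] [(x.1.inv, f)] rfl
    refine Joinable.trans ?_ h1.joinable
    simpa [AltWord.reversal] using h2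

end AltWord

open AltWord

/-! ### Hills of mountains and the three equivalences -/

namespace Mountain

noncomputable instance : Semigroup Mountain := cls_injective.semigroup cls cls_mul

/-- The steps of the two hills of a mountain with a given peak. -/
structure Hills (u : Mountain) (p : List (Anchor × Vertex)) (k : Vertex)
    (d : List (Anchor × Vertex)) : Prop where
  rises : Rises Vertex.one p
  lastOf_left : lastOf Vertex.one p = k
  falls : Falls k d
  lastOf_right : lastOf k d = Vertex.one
  steps_eq : u.1.steps = p ++ d

theorem exists_hills (u : Mountain) : ∃ p k d, u.Hills p k d := by
  obtain ⟨p, d, h, hp, hd⟩ := u.hill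
  have hl := u.lastOf_steps
  rw [h, lastOf_append] at hl
  exact ⟨p, _, d, hp, rfl, hd, hl, h⟩

/-- The mountain with given hills. -/
theorem exists_of_hills {p d : List (Anchor × Vertex)} {k : Vertex} (hp : Rises Vertex.one p)
    (hk : lastOf Vertex.one p = k) (hd : Falls k d) (hl : lastOf k d = Vertex.one) :
    ∃ u : Mountain, u.Hills p k d :=
  ⟨⟨⟨Vertex.one, p ++ d⟩, isMountain_iff.2 ⟨rfl, hill_append hp hk hd, by simp [hk, hl]⟩⟩,
    hp, hk, hd, hl, rfl⟩

namespace Hills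

variable {u v : Mountain} {p q d c : List (Anchor × Vertex)} {k m : Vertex}

theorem leftHill_eq (h : u.Hills p k d) : u.leftHill = ⟨Vertex.one, p⟩ := by
  rw [Mountain.leftHill, AltWord.leftHill, u.start_eq, h.steps_eq,
    climb_eq h.rises (h.lastOf_left ▸ h.falls)]

theorem rightHill_eq (h : u.Hills p k d) : u.rightHill = ⟨k, d⟩ := by
  rw [Mountain.rightHill, AltWord.rightHill, u.start_eq, h.steps_eq,
    descent_eq h.rises (h.lastOf_left ▸ h.falls), h.lastOf_left]

theorem peak_eq (h : u.Hills p k d) : u.peak = k := by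
  rw [peak, h.leftHill_eq]
  exact h.lastOf_left

theorem unique (h : u.Hills p k d) (h' : u.Hills q m c) : p = q ∧ k = m ∧ d = c := by
  have h1 := h.leftHill_eq.symm.trans h'.leftHill_eq
  have h2 := h.rightHill_eq.symm.trans h'.rightHill_eq
  exact ⟨(AltWord.mk.inj h1).2, AltWord.mk.inj h2⟩

theorem isGorge_iff (hu : u.Hills p k d) (hv : v.Hills q m c) :
    (u.rightHill.star v.leftHill).IsGorge ↔ Joinable k (d ++ q) [] := by
  rw [hu.rightHill_eq, hv.leftHill_eq]
  exact AltWord.isGorge_iff hu.falls hu.lastOf_right hv.rises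

theorem land_valley (hu : u.Hills p k d) (hv : v.Hills q m c) : Land k (d ++ q) :=
  along_append.2 ⟨hu.falls.land, by rw [hu.lastOf_right]; exact hv.rises.land⟩

theorem lastOf_valley (hu : u.Hills p k d) (hv : v.Hills q m c) : lastOf k (d ++ q) = m := by
  rw [lastOf_append, hu.lastOf_right, hv.lastOf_left]

theorem isIdempotentElem_iff (h : u.Hills p k d) :
    IsIdempotentElem u ↔ Joinable k (d ++ p) [] := by
  rw [IsIdempotentElem, mul_eq_iff, h.steps_eq]
  constructor
  · intro hj
    exact joinable_nil_of_absorbed h.rises h.lastOf_left h.falls (h.land_valley h)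
      (h.lastOf_valley h) (by simpa using hj)
  · intro hj
    simpa using hj.between p d h.lastOf_left

theorem mul_mul_eq_iff {u v w z : Mountain} :
    u * v * w = z ↔ Joinable Vertex.one (u.1.steps ++ v.1.steps ++ w.1.steps) z.1.steps := by
  have h := ((mul_steps u v).append_right w.1.steps).joinable
  rw [mul_eq_iff]
  exact ⟨h.trans, h.symm.trans⟩

theorem isInverse_iff (hu : u.Hills p k d) (hv : v.Hills q m c) :
    IsInverse v u ↔ Joinable k (d ++ q) [] ∧ Joinable m (c ++ p) [] := by
  rw [IsInverse, mul_mul_eq_iff, mul_mul_eq_iff, hu.steps_eq, hv.steps_eq]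
  have hA := hu.land_valley hv
  have hA' := hu.lastOf_valley hv
  have hB := hv.land_valley hu
  have hB' := hv.lastOf_valley hu
  constructor
  · rintro ⟨h1, h2⟩
    have h1 : Joinable k ((d ++ q) ++ (c ++ p)) [] :=
      joinable_nil_of_absorbed hu.rises hu.lastOf_left hu.falls
        (along_append.2 ⟨hA, by rwa [hA']⟩) (by rw [lastOf_append, hA', hB']) (by simpa using h1)
    have h2 : Joinable m ((c ++ p) ++ (d ++ q)) [] :=
      joinable_nil_of_absorbed hv.rises hv.lastOf_left hv.falls
        (along_append.2 ⟨hB, by rwa [hB']⟩) (by rw [lastOf_append, hB', hA']) (by simpa using h2)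
    obtain ⟨p₁, d₁, hp₁, hd₁, hl₁, hj₁⟩ := Steps.exists_joinable hA
    obtain ⟨p₂, d₂, hp₂, hd₂, hl₂, hj₂⟩ := Steps.exists_joinable hB
    rw [hA', ← lastOf_append] at hl₁
    rw [hB', ← lastOf_append] at hl₂
    -- One order of the product kills `p₁` and `d₂`, the other kills `p₂` and `d₁`.
    obtain ⟨rfl, rfl⟩ := eq_nil_of_joinable_nil hp₁ hd₁ hl₁ hp₂ hd₂
      ((hj₁.append hA' hj₂).symm.trans h1)
    obtain ⟨rfl, rfl⟩ := eq_nil_of_joinable_nil hp₂ hd₂ hl₂ hp₁ hd₁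
      ((hj₂.append hB' hj₁).symm.trans h2)
    exact ⟨hj₁, hj₂⟩
  · rintro ⟨h1, h2⟩
    obtain rfl : m = k := hA'.symm.trans h1.lastOf_eq
    have h3 : Joinable m ((d ++ q) ++ (c ++ p)) [] := h1.append hA' h2
    have h4 : Joinable m ((c ++ p) ++ (d ++ q)) [] := h2.append hB' h1
    exact ⟨by simpa using h3.between p d hu.lastOf_left,
      by simpa using h4.between q c hv.lastOf_left⟩

/-- Every mountain has an inverse, obtained by reversing it. -/
theorem exists_reversal (h : u.Hills p k d) :
    ∃ w : Mountain, w.Hills (reversal k d) k (reversal Vertex.one p) :=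
  exists_of_hills (by simpa [h.lastOf_right] using h.falls.reversal)
    (by simpa [h.lastOf_right] using lastOf_reversal k d)
    (by simpa [h.lastOf_left] using h.rises.reversal)
    (by simpa [h.lastOf_left] using lastOf_reversal Vertex.one p)

theorem joinable_left (h : u.Hills p k d) : Joinable k (reversal Vertex.one p ++ p) [] := by
  simpa [h.lastOf_left] using h.rises.joinable_reversal

theorem joinable_right (h : u.Hills p k d) : Joinable k (d ++ reversal k d) [] :=
  h.falls.joinable_reversal

/-- The right hill of a left multiple of `u` ends with the right hill of `u`. -/
theorem exists_right_of_eq_mul (hu : u.Hills p k d) (hv : v.Hills q m c) {e : Mountain}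
    (h : v = e * u) : ∃ D, c = D ++ d ∧ lastOf m D = k := by
  obtain ⟨pe, ke, de, he⟩ := e.exists_hills
  obtain ⟨p₁, d₁, hp₁, hd₁, hl₁, hj₁⟩ := Steps.exists_joinable (he.land_valley hu)
  rw [he.lastOf_valley hu] at hl₁
  -- Only the valley between the two peaks changes in the product, so the descent `d` survives as
  -- the end of the new right hill.
  obtain ⟨w, hw⟩ := exists_of_hills (p := pe ++ p₁) (d := d₁ ++ d) (k := lastOf ke p₁)
    (along_append.2 ⟨he.rises, by rwa [he.lastOf_left]⟩) (by rw [lastOf_append, he.lastOf_left])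
    (along_append.2 ⟨hd₁, hl₁ ▸ hu.falls⟩) (by rw [lastOf_append, hl₁, hu.lastOf_right])
  have hvw : v = w := by
    rw [h, mul_eq_iff, he.steps_eq, hu.steps_eq, hw.steps_eq]
    simpa using hj₁.between pe d he.lastOf_left
  subst hvw
  obtain ⟨-, rfl, rfl⟩ := hv.unique hw
  exact ⟨d₁, rfl, hl₁⟩

/-- The left hill of a right multiple of `u` starts with the left hill of `u`. -/
theorem exists_left_of_eq_mul (hu : u.Hills p k d) (hv : v.Hills q m c) {f : Mountain}
    (h : v = u * f) : ∃ P, q = p ++ P ∧ lastOf k P = m := by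
  obtain ⟨pf, kf, df, hf⟩ := f.exists_hills
  obtain ⟨p₁, d₁, hp₁, hd₁, hl₁, hj₁⟩ := Steps.exists_joinable (hu.land_valley hf)
  rw [hu.lastOf_valley hf] at hl₁
  obtain ⟨w, hw⟩ := exists_of_hills (p := p ++ p₁) (d := d₁ ++ df) (k := lastOf k p₁)
    (along_append.2 ⟨hu.rises, by rwa [hu.lastOf_left]⟩) (by rw [lastOf_append, hu.lastOf_left])
    (along_append.2 ⟨hd₁, hl₁ ▸ hf.falls⟩) (by rw [lastOf_append, hl₁, hf.lastOf_right])
  have hvw : v = w := by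
    rw [h, mul_eq_iff, hu.steps_eq, hf.steps_eq, hw.steps_eq]
    simpa using hj₁.between p df hu.lastOf_left
  subst hvw
  obtain ⟨rfl, rfl, -⟩ := hv.unique hw
  exact ⟨p₁, rfl, rfl⟩

/-- The natural partial order in terms of the hills. -/
theorem naturalLE_iff (hu : u.Hills p k d) (hv : v.Hills q m c) :
    NaturalLE v u ↔ ∃ D P, c = D ++ d ∧ q = p ++ P ∧ lastOf m D = k ∧ lastOf k P = m ∧
      Joinable m (D ++ P) [] := by
  obtain ⟨w, hw⟩ := hu.exists_reversal
  have hl := hu.joinable_left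
  have hr := hu.joinable_right
  constructor
  · rintro ⟨e, f, he, hf, heu, huf⟩
    obtain ⟨D, rfl, hD⟩ := exists_right_of_eq_mul hu hv heu
    obtain ⟨P, rfl, hP⟩ := exists_left_of_eq_mul hu hv huf
    refine ⟨D, P, rfl, rfl, hD, hP, ?_⟩
    have hfalls := (along_append.1 hv.falls).1
    have hrises := (along_append.1 hv.rises).2
    rw [hu.lastOf_left] at hrises
    have huwu : u * w * u = u :=
      ((isInverse_iff hu hw).2 ⟨hr, hl⟩).1
    have hvwv : v * w * v = v := by
      -- With the first `v` written as `e u` and the second as `u f`, this is `e (u w u) f = e u f =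
      -- e v = e e u = v`.
      calc v * w * v = e * (u * w * u) * f := by
            conv_lhs => rw [heu]
            rw [← heu]
            conv_lhs => enter [2]; rw [huf]
            rw [heu]
            simp only [mul_assoc]
        _ = v := by rw [huwu, mul_assoc, ← huf, heu, ← mul_assoc, he.eq]
    rw [mul_mul_eq_iff, hv.steps_eq, hw.steps_eq] at hvwv
    -- The word of `v w v` contains `d` followed by its reversal, and the reversal of `p` followed
    -- by `p`. Both pairs vanish, and what is left between the hills of `v` is the loop `D P`.
    have h1 : Joinable Vertex.one
        ((p ++ P) ++ (D ++ (d ++ reversal k d) ++ (reversal Vertex.one p ++ p) ++ P) ++ (D ++ d))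
        ((p ++ P) ++ (D ++ P) ++ (D ++ d)) := by
      refine Joinable.between _ _ hv.lastOf_left ?_
      refine (Joinable.between (D ++ (d ++ reversal k d)) P ?_ hl).trans ?_
      · rw [lastOf_append, hD]
        exact hr.lastOf_eq
      · simpa using hr.between D P hD
    refine joinable_nil_of_absorbed hv.rises hv.lastOf_left hv.falls
      (along_append.2 ⟨Falls.land hfalls, by rw [hD]; exact Rises.land hrises⟩)
      (by rw [lastOf_append, hD, hP]) (h1.symm.trans (by simpa using hvwv))
  · rintro ⟨D, P, rfl, rfl, hD, hP, hj⟩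
    have hfalls := (along_append.1 hv.falls).1
    have hrises := (along_append.1 hv.rises).2
    rw [hu.lastOf_left] at hrises
    -- The idempotents are the reductions of `v w` and `w v`, where `w` is the reversal of `u`:
    -- namely `p P D` followed by reversed `p`, and reversed `d` followed by `P D d`.
    obtain ⟨e, he⟩ := exists_of_hills (p := p ++ P) (k := m) (d := D ++ reversal Vertex.one p)
      hv.rises hv.lastOf_left (along_append.2 ⟨hfalls, hD ▸ hw.falls⟩)
      (by rw [lastOf_append, hD, hw.lastOf_right])
    obtain ⟨f, hf⟩ := exists_of_hills (p := reversal k d ++ P) (k := m) (d := D ++ d)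
      (along_append.2 ⟨hw.rises, by rwa [hw.lastOf_left]⟩)
      (by rw [lastOf_append, hw.lastOf_left, hP]) hv.falls hv.lastOf_right
    refine ⟨e, f, he.isIdempotentElem_iff.2 ?_, hf.isIdempotentElem_iff.2 ?_,
      (mul_eq_iff.2 ?_).symm, (mul_eq_iff.2 ?_).symm⟩
    · refine Joinable.trans ?_ hj
      simpa using hl.between D P hD
    · refine Joinable.trans ?_ hj
      simpa using hr.between D P hD
    · rw [he.steps_eq, hu.steps_eq, hv.steps_eq]
      simpa using hl.between (p ++ P ++ D) d (by rw [lastOf_append, hv.lastOf_left, hD])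
    · rw [hu.steps_eq, hf.steps_eq, hv.steps_eq]
      simpa using hr.between p (P ++ (D ++ d)) hu.lastOf_left

theorem naturalLT_iff (hu : u.Hills p k d) (hv : v.Hills q m c) :
    NaturalLT v u ↔ GorgeExtension v u := by
  have mem : ∀ g : Vertex, g.height ≠ 0 → g.1 ∈ G5 := by
    rintro ⟨g, rfl | h⟩ hg
    · exact (hg rfl).elim
    · exact h
  rw [NaturalLT, naturalLE_iff hu hv, GorgeExtension, hu.leftHill_eq, hu.rightHill_eq,
    hv.leftHill_eq, hv.rightHill_eq, hu.peak_eq]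
  constructor
  · rintro ⟨⟨D, P, rfl, rfl, hD, hP, hj⟩, hne⟩
    have hfalls := (along_append.1 hv.falls).1
    have hrises := (along_append.1 hv.rises).2
    rw [hu.lastOf_left] at hrises
    -- Both lengths equal the height difference between `m` and `k`, so `D` and `P` are empty
    -- together, exactly when `v = u`.
    have h1 := Falls.height_lastOf hfalls
    have h2 := Rises.height_lastOf hrises
    rw [hD] at h1
    rw [hP] at h2
    have hlen : D.length ≠ 0 := by
      intro h
      obtain rfl : D = [] := List.length_eq_zero_iff.1 h
      obtain rfl : P = [] := List.length_eq_zero_iff.1 (by omega)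
      exact hne (ext_steps (by simpa [hu.steps_eq] using hv.steps_eq))
    obtain _ | ⟨⟨a₁, g⟩, t⟩ := P
    · simp at h2
      omega
    obtain rfl | ⟨s, ⟨a₂, k'⟩, rfl⟩ := D.eq_nil_or_concat'
    · exact (hlen rfl).elim
    obtain rfl : k' = k := by simpa using hD
    -- The first step of `P` and the last step of `D` are split off at `k`; what remains may have no
    -- steps, and is then a letter of positive height, hence in `G5`.
    refine ⟨a₁, a₂, ⟨g, t⟩, ⟨m, s⟩, ?_, ?_, rfl, by simp [join], ?_⟩
    · rcases eq_or_ne t [] with rfl | ht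
      · exact Or.inr ⟨g, mem g (by have := Vertex.Up.height_eq hrises.1; omega), rfl⟩
      · exact Or.inl (isUphill_iff.2 ⟨hrises.2, ht⟩)
    · rcases eq_or_ne s [] with rfl | hs
      · exact Or.inr ⟨m, mem m (by omega), rfl⟩
      · exact Or.inl (isDownhill_iff.2 ⟨(along_append.1 hfalls).1, hs⟩)
    · simpa [join, single] using (AltWord.isGorge_iff hfalls hD hrises).2 hj
  · rintro ⟨a₁, a₂, u₁, u₂, -, -, h1, h2, h3⟩
    obtain rfl : q = p ++ (a₁, u₁.start) :: u₁.steps := (AltWord.mk.inj h1).2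
    obtain ⟨rfl, rfl⟩ : m = u₂.start ∧ c = u₂.steps ++ (a₂, k) :: d := AltWord.mk.inj h2
    have hc : u₂.steps ++ (a₂, k) :: d = (u₂.steps ++ [(a₂, k)]) ++ d := by simp
    have hfalls := hv.falls
    rw [hc] at hfalls
    have hfalls := (along_append.1 hfalls).1
    have hrises := (along_append.1 hv.rises).2
    rw [hu.lastOf_left] at hrises
    have hD : lastOf u₂.start (u₂.steps ++ [(a₂, k)]) = k := by simp
    refine ⟨⟨u₂.steps ++ [(a₂, k)], _, hc, rfl, hD, ?_, ?_⟩, ?_⟩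
    · have := hv.lastOf_left
      rwa [lastOf_append, hu.lastOf_left] at this
    · exact (AltWord.isGorge_iff hfalls hD hrises).1 (by simpa [join, single] using h3)
    · rintro rfl
      have := (hu.unique hv).1
      simp at this

end Hills

theorem isIdempotentElem_cls_iff {u : Mountain} :
    IsIdempotentElem u.cls ↔ IsIdempotentElem u := by
  rw [IsIdempotentElem, ← cls_mul, cls_injective.eq_iff, IsIdempotentElem]

theorem isInverse_cls_iff {u v : Mountain} : IsInverse v.cls u.cls ↔ IsInverse v u := by
  simp only [IsInverse, ← cls_mul, cls_injective.eq_iff]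

/-- Surjectivity of `cls` is needed here, since the idempotents witnessing the order range over all
of `FOne`. -/
theorem naturalLT_cls_iff {u v : Mountain} : NaturalLT v.cls u.cls ↔ NaturalLT v u := by
  simp only [NaturalLT, NaturalLE, cls_surjective.exists, isIdempotentElem_cls_iff, ← cls_mul,
    cls_injective.eq_iff, ne_eq]

end Mountain

end FreeRegular

theorem mainTheorem8 (u v : FreeRegular.Mountain) :
    -- (i) idempotents, among mountains and in the presented monoid
    ((IsIdempotentElem u ↔ (u.rightHill.star u.leftHill).IsGorge) ∧
      (IsIdempotentElem u.cls ↔ (u.rightHill.star u.leftHill).IsGorge)) ∧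
    -- (ii) inverses
    ((FreeRegular.IsInverse v u ↔
        (u.rightHill.star v.leftHill).IsGorge ∧ (v.rightHill.star u.leftHill).IsGorge) ∧
      (FreeRegular.IsInverse v.cls u.cls ↔
        (u.rightHill.star v.leftHill).IsGorge ∧ (v.rightHill.star u.leftHill).IsGorge)) ∧
    -- (iii) the natural partial order
    ((FreeRegular.NaturalLT v u ↔ FreeRegular.GorgeExtension v u) ∧
      (FreeRegular.NaturalLT v.cls u.cls ↔ FreeRegular.GorgeExtension v u)) := by
  obtain ⟨p, k, d, hu⟩ := u.exists_hills
  obtain ⟨q, m, c, hv⟩ := v.exists_hills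
  rw [FreeRegular.Mountain.isIdempotentElem_cls_iff, FreeRegular.Mountain.isInverse_cls_iff,
    FreeRegular.Mountain.naturalLT_cls_iff, hu.isGorge_iff hu, hu.isGorge_iff hv,
    hv.isGorge_iff hu, and_self, and_self, and_self]
  exact ⟨hu.isIdempotentElem_iff, hu.isInverse_iff hv, hu.naturalLT_iff hv⟩
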